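/- Let $M,N,k\ge 1$ be integers. Let $\lambda=(\lambda_1\ge\dots\ge\lambda_k)$ be a weakly decreasing tuple of integers in $\{0,\dots,M-1\}$ and let $r=(r_1<\dots<r_k)$ be a strictly increasing tuple of integers in $\{1,\dots,N\}$. Notation. $\operatorname{perm}(v)$ is the set of distinct permutations of a $k$-tuple $v$; $v^\uparrow$ and $v^\downarrow$ are $v$ sorted in non-decreasing and non-increasing order; $v\ge 0$ means that all entries are nonnegative. If $v$ has distinct entries and $p\in\operatorname{perm}(v)$, then $\operatorname{sign}_v(p)=(-1)^m$, where $m$ is the number of transpositions in any sequence of transpositions leading from $v$ to $p$. $\mathcal D_\lambda$ is the set of weakly decreasing $k$-tuples $\mu$ of nonnegative integers with $\sum_i\mu_i=\sum_i\lambda_i$. For $\mu\in\mathcal D_\lambda$, the Kostka number $K_{\lambda,\mu}$ is the number of semistandard Young tableaux of shape $\lambda$ and weight $\mu$ (each $i\in\{1,\dots,k\}$ occurs exactly $\mu_i$ times and there are no other entries; entries weakly increase along rows and strictly increase down columns). For weakly decreasing $k$-tuples $\gamma,\lambda,\mu$ of nonnegative integers with $\sum_i\gamma_i=\sum_i\lambda_i+\sum_i\mu_i$,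 the Littlewood–Richardson coefficient $c^{\gamma}_{\lambda,\mu}$ is the number of semistandard skew tableaux of shape $\gamma/\lambda$ and weight $\mu$ whose word, read row by row from top to bottom and from right to left in each row, is a lattice word (every prefix contains the letter $i$ at least as often as the letter $i+1$, for every $i\ge1$); it is $0$ if $\lambda\le\gamma$ (entrywise) fails. Let $$v^\ast\in\{(p+r)^\uparrow:\ \mu\in\mathcal D_\lambda,\ p\in\operatorname{perm}(\mu),\ (p+r)^\uparrow_i>(p+r)^\uparrow_{i-1}\text{ for } 2\le i\le k\},$$ $$\mathcal Q(v^\ast)=\{q\in\operatorname{perm}(v^\ast): q-r\ge0\},\qquad \mathcal P(v^\ast)=\{p\in\operatorname{perm}(r): v^\ast-p\ge0\}.$$ Then $$\sum_{q\in\mathcal Q(v^\ast)}\operatorname{sign}_{v^\ast}(q)\,K_{\lambda,(q-r)^\downarrow}=\sum_{p\in\mathcal P(v^\ast)}\operatorname{sign}_r(p)\,K_{\lambda,(v^\ast-p)^\downarrow}=c^{\gamma^\ast}_{\lambda,\varepsilon},$$ where $\gamma^\ast_i=v^\ast_{k-i+1}-k+i$ and $\varepsilon_i=r_{k-i+1}-k+i$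 for $1\le i\le k$. In particular, the sum is nonnegative. -/

import Mathlib

namespace KostkaLR

/-! Tuples of length `k` are functions `Fin k → ℕ`. Indices are zero-based, so the `i`-th entry of
a tuple in one-based notation is its value at `i - 1`. -/

/-- Strictly increasing `k`-tuples with entries in `{1, …, n}`. -/
def incTuples (n k : ℕ) : Set (Fin k → ℕ) :=
  {v | (∀ i, 1 ≤ v i ∧ v i ≤ n) ∧ StrictMono v}

/-- Weakly decreasing `k`-tuples with entries in `{0, …, n - 1}`. -/
def decTuples (n k : ℕ) : Set (Fin k → ℕ) :=
  {v | (∀ i, v i < n) ∧ Antitone v}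

/-- Weakly decreasing `k`-tuples of nonnegative integers with the same sum as `lam`. -/
def decTuplesOf {k : ℕ} (lam : Fin k → ℕ) : Set (Fin k → ℕ) :=
  {v | Antitone v ∧ ∑ i, v i = ∑ i, lam i}

/-- The tuple sorted in non-decreasing order. -/
def sortUp {k : ℕ} (v : Fin k → ℕ) : Fin k → ℕ := v ∘ Tuple.sort v

/-- The tuple sorted in non-increasing order. -/
def sortDown {k : ℕ} (v : Fin k → ℕ) : Fin k → ℕ := sortUp v ∘ Fin.rev

theorem sortUp_monotone {k : ℕ} (v : Fin k → ℕ) : Monotone (sortUp v) := Tuple.monotone_sort v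

theorem sortDown_antitone {k : ℕ} (v : Fin k → ℕ) : Antitone (sortDown v) :=
  fun _ _ h => sortUp_monotone v (Fin.rev_le_rev.2 h)

/-- The set of distinct permutations of the tuple `v`. -/
def perms {k : ℕ} (v : Fin k → ℕ) : Finset (Fin k → ℕ) :=
  Finset.univ.image fun σ : Equiv.Perm (Fin k) => v ∘ σ

open Classical in
/-- The parity of a rearrangement `p` of a tuple `v` with distinct entries: the sign of the
permutation that carries `v` to `p`. -/
noncomputable def parity {k : ℕ} (v p : Fin k → ℕ) : ℤ :=
  if h : ∃ σ : Equiv.Perm (Fin k), v ∘ σ = p then (Equiv.Perm.sign h.choose : ℤ) else 0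

theorem parity_comp {k : ℕ} {v : Fin k → ℕ} (hv : Function.Injective v)
    (σ : Equiv.Perm (Fin k)) : parity v (v ∘ σ) = (Equiv.Perm.sign σ : ℤ) := by
  have h : ∃ τ : Equiv.Perm (Fin k), v ∘ τ = v ∘ σ := ⟨σ, rfl⟩
  have h2 : h.choose = σ := Equiv.ext fun i => hv (congrFun h.choose_spec i)
  rw [parity, dif_pos h, h2]

/-- The boxes of the left-aligned diagram with `lam i` boxes in row `i`. -/
def boxes {k : ℕ} (lam : Fin k → ℕ) : Finset (ℕ × ℕ) :=
  Finset.univ.biUnion fun i : Fin k => {(i : ℕ)} ×ˢ Finset.range (lam i)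

theorem mem_boxes {k : ℕ} {lam : Fin k → ℕ} {c : ℕ × ℕ} :
    c ∈ boxes lam ↔ ∃ h : c.1 < k, c.2 < lam ⟨c.1, h⟩ := by
  simp only [boxes, Finset.mem_biUnion, Finset.mem_univ, true_and, Finset.mem_product,
    Finset.mem_singleton, Finset.mem_range]
  constructor
  · rintro ⟨i, h1, h2⟩
    have hi : c.1 < k := h1 ▸ i.2
    have e : (⟨c.1, hi⟩ : Fin k) = i := Fin.ext h1
    exact ⟨hi, e ▸ h2⟩
  · rintro ⟨h, h2⟩
    exact ⟨⟨c.1, h⟩, rfl, h2⟩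

/-- The Young diagram of a weakly decreasing tuple. -/
def diagram {k : ℕ} (lam : Fin k → ℕ) (hlam : Antitone lam) : YoungDiagram where
  cells := boxes lam
  isLowerSet := by
    rintro ⟨i, j⟩ ⟨i', j'⟩ ⟨hi, hj⟩ hc
    obtain ⟨h, h2⟩ := mem_boxes.1 (Finset.mem_coe.1 hc)
    have hi2 : i' ≤ i := hi
    have hj2 : j' ≤ j := hj
    refine Finset.mem_coe.2 (mem_boxes.2 ⟨lt_of_le_of_lt hi2 h, ?_⟩)
    exact lt_of_le_of_lt hj2 (lt_of_lt_of_le h2 (hlam (Fin.mk_le_mk.2 hi2)))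

/-- The Kostka number: the number of semistandard Young tableaux of shape `lam` and weight `mu`.
The letters are `0, …, k - 1`, and letter `a` occurs exactly `mu a` times. -/
noncomputable def kostka {k : ℕ} (lam : Fin k → ℕ) (hlam : Antitone lam) (mu : Fin k → ℕ) : ℕ :=
  Nat.card {T : SemistandardYoungTableau (diagram lam hlam) //
    (∀ c ∈ boxes lam, T c.1 c.2 < k) ∧
    ∀ a : Fin k, ((boxes lam).filter fun c => T c.1 c.2 = a).card = mu a}

/-- The boxes that belong to the diagram of `gam` but not to the diagram of `lam`. -/
def skewBoxes {k : ℕ} (gam lam : Fin k → ℕ) : Finset (ℕ × ℕ) := boxes gam \ boxes lam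

/-- A semistandard filling of the skew diagram `gam / lam`: weakly increasing along rows, strictly
increasing down columns. As for Mathlib's straight tableaux, the entry function is normalised to
vanish off the diagram. -/
structure SkewTableau {k : ℕ} (gam lam : Fin k → ℕ) where
  entry : ℕ → ℕ → ℕ
  row_weak : ∀ {i j1 j2 : ℕ}, j1 < j2 → (i, j1) ∈ skewBoxes gam lam →
    (i, j2) ∈ skewBoxes gam lam → entry i j1 ≤ entry i j2
  col_strict : ∀ {i1 i2 j : ℕ}, i1 < i2 → (i1, j) ∈ skewBoxes gam lam →
    (i2, j) ∈ skewBoxes gam lam → entry i1 j < entry i2 j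
  zeros : ∀ {i j : ℕ}, (i, j) ∉ skewBoxes gam lam → entry i j = 0

/-- The tableau has weight `mu`: the letters are `0, …, k - 1`, and letter `a` occurs exactly
`mu a` times. -/
def SkewTableau.HasWeight {k : ℕ} {gam lam : Fin k → ℕ} (T : SkewTableau gam lam)
    (mu : Fin k → ℕ) : Prop :=
  (∀ c ∈ skewBoxes gam lam, T.entry c.1 c.2 < k) ∧
  ∀ a : Fin k, ((skewBoxes gam lam).filter fun c => T.entry c.1 c.2 = a).card = mu a

/-- The boxes that have been read once the box `c` has been reached, when the rows are read from
top to bottom and each row from right to left. -/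
def readUpTo {k : ℕ} (gam lam : Fin k → ℕ) (c : ℕ × ℕ) : Finset (ℕ × ℕ) :=
  (skewBoxes gam lam).filter fun d => d.1 < c.1 ∨ (d.1 = c.1 ∧ c.2 ≤ d.2)

/-- The word read off row by row, from top to bottom and from right to left, is a lattice word:
every (nonempty) prefix contains each letter `a` at least as often as the letter `a + 1`. -/
def SkewTableau.IsLattice {k : ℕ} {gam lam : Fin k → ℕ} (T : SkewTableau gam lam) : Prop :=
  ∀ c ∈ skewBoxes gam lam, ∀ a : ℕ,
    ((readUpTo gam lam c).filter fun d => T.entry d.1 d.2 = a + 1).card ≤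
      ((readUpTo gam lam c).filter fun d => T.entry d.1 d.2 = a).card

open Classical in
/-- The Littlewood–Richardson coefficient `c^gam_{lam, mu}`: the number of semistandard tableaux of
shape `gam / lam` and weight `mu` whose reading word is a lattice word; it is `0` when the diagram
of `lam` is not contained in that of `gam`. -/
noncomputable def lrCoeff {k : ℕ} (gam lam mu : Fin k → ℕ) : ℕ :=
  if lam ≤ gam then Nat.card {T : SkewTableau gam lam // T.HasWeight mu ∧ T.IsLattice} else 0

/-- The tuples `v = (p + r)↑` with strictly increasing entries, where `p` is a permutation of a
weakly decreasing tuple `mu` with the same sum as `lam`. -/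
def admissible {k : ℕ} (lam r : Fin k → ℕ) : Set (Fin k → ℕ) :=
  {v | ∃ mu ∈ decTuplesOf lam, ∃ p ∈ perms mu, v = sortUp (p + r) ∧ StrictMono v}

/-- The permutations `q` of `v` with `q - r ≥ 0`. -/
def setQ {k : ℕ} (r v : Fin k → ℕ) : Finset (Fin k → ℕ) := (perms v).filter fun q => ∀ i, r i ≤ q i

/-- The permutations `p` of `r` with `v - p ≥ 0`. -/
def setP {k : ℕ} (r v : Fin k → ℕ) : Finset (Fin k → ℕ) := (perms r).filter fun p => ∀ i, p i ≤ v i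

/-- The tuple whose `i`-th entry (one-based) is `v_{k-i+1} - k + i`. It is only used for strictly
increasing `v`, where the subtraction does not truncate: see `cast_toPartition`. -/
def toPartition {k : ℕ} (v : Fin k → ℕ) : Fin k → ℕ :=
  fun i => v i.rev + (i + 1) - k

theorem cast_toPartition {k : ℕ} {v : Fin k → ℕ} (hv : StrictMono v) (hpos : ∀ i, 1 ≤ v i)
    (i : Fin k) : (toPartition v i : ℤ) = (v i.rev : ℤ) - k + (i + 1) := by
  have key : ∀ (n : ℕ) (hn : n < k), n + 1 ≤ v ⟨n, hn⟩ := by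
    intro n
    induction n with
    | zero => intro hn; exact hpos _
    | succ m ih =>
      intro hn
      have h1 := ih (by omega)
      have h2 : v ⟨m, by omega⟩ < v ⟨m + 1, hn⟩ := hv (Fin.mk_lt_mk.2 (Nat.lt_succ_self m))
      omega
  have h := key (i.rev : ℕ) i.rev.2
  have hr : (i.rev : ℕ) = k - (i + 1) := Fin.val_rev i
  have hi := i.2
  have h3 : (i.rev : ℕ) + 1 ≤ v i.rev := h
  unfold toPartition
  omega

end KostkaLR

/-! Write s_λ for the Schur polynomial, a_α = Σ_σ sign(σ) x^(α∘σ) for the alternant and ρ = (k-1, …,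
0). Since ε + ρ and γ* + ρ are r and v* reversed, the sum over P is the coefficient of x^(γ*+ρ) in
s_λ a_(ε+ρ). Kostka numbers do not depend on the order of the weight, so inverting the permutation
turns the sum over Q into the sum over P.

By the bialternant formula, s_λ a_(ε+ρ) = s_λ s_ε a_ρ = s_ε a_(λ+ρ) (`schur_mul_alternant_comm`).
Symmetry of s_ε expands the last product as Σ a_(λ+ρ+wt T) over tableaux T of shape ε. Tableaux that
are not λ-dominant cancel in pairs: a Bender–Knuth reflection to the left of the last violating
column swaps two entries of the exponent (`schur_mul_alternant_dominant`). The case λ = 0 yields the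
bialternant formula itself. Hence the coefficient counts the λ-dominant T with λ + wt T = γ*
(`sum_sign_gtCount`).

Exchanging the roles of rows and letters (`companion`) turns these T into Littlewood–Richardson
tableaux of shape γ*/λ and weight ε (`lrCoeff_eq_card`). The cancellation needs dominance by columns
and the companion map needs it by rows; `colDominant_iff` shows that the two agree. Tableaux are
encoded by Gelfand–Tsetlin patterns, so that all conditions become linear inequalities. -/

namespace KostkaLR

open Finset

/-! ### Gelfand–Tsetlin patterns. -/

/-- Gelfand–Tsetlin patterns with top row `e`: `x j r` is the number of entries `< j` in row `r` of
the corresponding semistandard tableau of shape `e` with letters `0, …, k - 1`. -/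
structure IsGT (k : ℕ) (e : ℕ → ℕ) (x : ℕ → ℕ → ℕ) : Prop where
  zero : ∀ r, x 0 r = 0
  top : ∀ j, k ≤ j → ∀ r, x j r = e r
  le : ∀ j r, x j r ≤ x (j + 1) r
  inter : ∀ j r, x (j + 1) (r + 1) ≤ x j r

namespace IsGT

variable {k : ℕ} {e : ℕ → ℕ} {x : ℕ → ℕ → ℕ}

theorem mono (h : IsGT k e x) (r : ℕ) : Monotone fun j => x j r :=
  monotone_nat_of_le_succ fun j => h.le j r

theorem anti (h : IsGT k e x) (j : ℕ) : Antitone (x j) :=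
  antitone_nat_of_succ_le fun r => (h.le j (r + 1)).trans (h.inter j r)

theorem eq_zero (h : IsGT k e x) : ∀ {j r : ℕ}, j ≤ r → x j r = 0
  | 0, r, _ => h.zero r
  | j + 1, 0, hr => by omega
  | j + 1, r + 1, hr => by
    have h1 := h.inter j r
    have h2 := h.eq_zero (j := j) (r := r) (by omega)
    omega

theorem le_top (h : IsGT k e x) (j r : ℕ) : x j r ≤ e r := by
  rw [← h.top (max j k) (le_max_right _ _) r]
  exact h.mono r (le_max_left _ _)

theorem le_top_zero (h : IsGT k e x) (j r : ℕ) : x j r ≤ e 0 :=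
  (h.anti j (Nat.zero_le r)).trans (h.le_top j 0)

end IsGT

theorem finite_isGT (k : ℕ) (e : ℕ → ℕ) : {x | IsGT k e x}.Finite := by
  -- A pattern is determined by its entries with `j, r < k`: rows from `k` on equal `e`, and entries
  -- with `j ≤ r` vanish.
  refine Set.Finite.of_finite_image
    (f := fun (x : ℕ → ℕ → ℕ) (j r : Fin k) => x j r) ?_ ?_
  · refine (Set.finite_Icc (0 : Fin k → Fin k → ℕ) (fun _ _ => e 0)).subset ?_
    rintro _ ⟨x, hx, rfl⟩
    exact ⟨fun _ _ => Nat.zero_le _, fun j r => IsGT.le_top_zero hx j r⟩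
  · intro x hx y hy hxy
    have hx' : IsGT k e x := hx
    have hy' : IsGT k e y := hy
    funext j r
    by_cases hj : k ≤ j
    · rw [hx'.top j hj, hy'.top j hj]
    by_cases hr : j ≤ r
    · rw [hx'.eq_zero hr, hy'.eq_zero hr]
    · exact congrFun (congrFun hxy ⟨j, by omega⟩) ⟨r, by omega⟩

/-- The finite set of Gelfand–Tsetlin patterns with top row `e`. -/
noncomputable def gtSet (k : ℕ) (e : ℕ → ℕ) : Finset (ℕ → ℕ → ℕ) := (finite_isGT k e).toFinset

@[simp] theorem mem_gtSet {k : ℕ} {e : ℕ → ℕ} {x : ℕ → ℕ → ℕ} : x ∈ gtSet k e ↔ IsGT k e x := by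
  simp [gtSet]

/-! ### Reflection of a single row of a pattern. -/

/-- Upper end of the interval in which the `r`-th entry of a row between `q` and `p` may vary, cut
off at `c`. -/
def upperEnd (c : ℕ) (p q : ℕ → ℕ) : ℕ → ℕ
  | 0 => min (p 0) c
  | r + 1 => min (min (p (r + 1)) (q r)) c

/-- Reflection of a row `y` lying between the rows `q` and `p` of a pattern, acting on the part of
the tableau in the columns before `c`. -/
def reflectRow (c : ℕ) (p q y : ℕ → ℕ) (r : ℕ) : ℕ :=
  if c < q r then y r else max (p (r + 1)) (q r) + upperEnd c p q r - y r

section reflectRow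

variable {c : ℕ} {p q y : ℕ → ℕ}

theorem le_upperEnd (h2 : ∀ r, y r ≤ p r) (h4 : ∀ r, y (r + 1) ≤ q r) {r : ℕ} (hc : y r ≤ c) :
    y r ≤ upperEnd c p q r := by
  cases r with
  | zero => exact le_min (h2 0) hc
  | succ r => exact le_min (le_min (h2 _) (h4 r)) hc

theorem upperEnd_le (r : ℕ) : upperEnd c p q r ≤ c := by
  cases r <;> exact min_le_right _ _

theorem upperEnd_le_left (r : ℕ) : upperEnd c p q r ≤ p r := by
  cases r with
  | zero => exact min_le_left _ _
  | succ r => exact (min_le_left _ _).trans (min_le_left _ _)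

theorem upperEnd_succ_le (r : ℕ) : upperEnd c p q (r + 1) ≤ q r :=
  (min_le_left _ _).trans (min_le_right _ _)

/-- The lower end for entry `r` and the upper end for entry `r + 1` are the maximum and the minimum
of the same pair `p (r + 1)`, `q r`; after capping at `c` they add up to the sum of that pair. -/
theorem sum_upperEnd (n : ℕ) :
    ∑ r ∈ range n, (min (max (p (r + 1)) (q r)) c + upperEnd c p q r) + upperEnd c p q n =
      ∑ r ∈ range (n + 1), min (p r) c + ∑ r ∈ range n, min (q r) c := by
  induction n with
  | zero => simp [upperEnd]
  | succ n ih =>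
    rw [sum_range_succ, sum_range_succ _ (n + 1), sum_range_succ (fun r => min (q r) c)]
    have : min (max (p (n + 1)) (q n)) c + upperEnd c p q (n + 1) =
        min (p (n + 1)) c + min (q n) c := by
      simp only [upperEnd]; omega
    omega

-- For `p`, `y`, `q` the rows `i + 2`, `i + 1`, `i` of a pattern, `hc` says that column `c` contains
-- no letter `i`. Rows with `c < q r` then have only letters below `i` before column `c`, and in all
-- other rows `y r ≤ c`.
variable (h1 : ∀ r, p (r + 1) ≤ y r) (h2 : ∀ r, y r ≤ p r) (h3 : ∀ r, q r ≤ y r)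
  (h4 : ∀ r, y (r + 1) ≤ q r) (hc : ∀ r, c < y r → c < q r)
include h1 h2 h3 h4 hc

theorem reflectRow_bounds (r : ℕ) (hr : ¬ c < q r) :
    y r ≤ upperEnd c p q r ∧ max (p (r + 1)) (q r) ≤ y r ∧
    reflectRow c p q y r + y r = max (p (r + 1)) (q r) + upperEnd c p q r := by
  have hy : y r ≤ c := by by_contra h; exact hr (hc r (by omega))
  have hu := le_upperEnd h2 h4 hy
  have := h1 r
  have := h3 r
  rw [reflectRow, if_neg hr]
  omega

theorem le_reflectRow (r : ℕ) : p (r + 1) ≤ reflectRow c p q y r ∧ q r ≤ reflectRow c p q y r ∧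
    reflectRow c p q y r ≤ p r := by
  by_cases hr : c < q r
  · rw [reflectRow, if_pos hr]; exact ⟨h1 r, h3 r, h2 r⟩
  · have h := reflectRow_bounds h1 h2 h3 h4 hc r hr
    have := upperEnd_le_left (c := c) (p := p) (q := q) r
    omega

theorem reflectRow_succ_le (r : ℕ) : reflectRow c p q y (r + 1) ≤ q r := by
  by_cases hr : c < q (r + 1)
  · rw [reflectRow, if_pos hr]; exact h4 r
  · have h := reflectRow_bounds h1 h2 h3 h4 hc _ hr
    have := upperEnd_succ_le (c := c) (p := p) (q := q) r
    omega

theorem lt_of_lt_reflectRow (r : ℕ) (h : c < reflectRow c p q y r) : c < q r := by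
  by_contra hr
  have h := reflectRow_bounds h1 h2 h3 h4 hc _ hr
  have := upperEnd_le (c := c) (p := p) (q := q) r
  omega

theorem reflectRow_reflectRow (r : ℕ) : reflectRow c p q (reflectRow c p q y) r = y r := by
  by_cases hr : c < q r
  · rw [reflectRow, if_pos hr, reflectRow, if_pos hr]
  · have h := reflectRow_bounds h1 h2 h3 h4 hc _ hr
    rw [reflectRow, if_neg hr]
    omega

theorem max_reflectRow {d : ℕ} (hd : c ≤ d) (r : ℕ) :
    max (reflectRow c p q y r) d = max (y r) d := by
  by_cases hr : c < q r
  · rw [reflectRow, if_pos hr]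
  · have h := reflectRow_bounds h1 h2 h3 h4 hc _ hr
    have := upperEnd_le (c := c) (p := p) (q := q) r
    omega

/-- An entry and its mirror image add up to the two ends of the interval, and a row with `c < q r`
contributes `c` to every term. The total is thus independent of `y`, which allows summation by
`sum_upperEnd`. -/
theorem min_reflectRow_add (r : ℕ) : min (reflectRow c p q y r) c + min (y r) c =
    min (max (p (r + 1)) (q r)) c + upperEnd c p q r := by
  by_cases hr : c < q r
  · have := h3 r
    have hu : upperEnd c p q r = c := by
      cases r with
      | zero => have := h2 0; simp only [upperEnd]; omega
      | succ r => have := h2 (r + 1); have := h4 r; simp only [upperEnd]; omega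
    rw [reflectRow, if_pos hr, hu]
    omega
  · have h := reflectRow_bounds h1 h2 h3 h4 hc _ hr
    have := upperEnd_le (c := c) (p := p) (q := q) r
    omega

theorem sum_min_reflectRow {n : ℕ} (hn : p n = 0) :
    ∑ r ∈ range n, min (reflectRow c p q y r) c + ∑ r ∈ range n, min (y r) c =
      ∑ r ∈ range n, min (p r) c + ∑ r ∈ range n, min (q r) c := by
  rw [← sum_add_distrib, sum_congr rfl fun r _ => min_reflectRow_add h1 h2 h3 h4 hc r]
  have h := sum_upperEnd (c := c) (p := p) (q := q) n
  have hu := upperEnd_le_left (c := c) (p := p) (q := q) n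
  rw [sum_range_succ _ n, hn] at h
  omega

end reflectRow

/-! ### Bender–Knuth reflections of patterns. -/

/-- The Bender–Knuth reflection of the letters `i` and `i + 1` in the columns before `c`. -/
def bk (c i : ℕ) (x : ℕ → ℕ → ℕ) : ℕ → ℕ → ℕ :=
  Function.update x (i + 1) (reflectRow c (x (i + 2)) (x i) (x (i + 1)))

theorem bk_of_ne {c i j : ℕ} (x : ℕ → ℕ → ℕ) (h : j ≠ i + 1) : bk c i x j = x j :=
  Function.update_of_ne h _ _

theorem bk_self (c i : ℕ) (x : ℕ → ℕ → ℕ) :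
    bk c i x (i + 1) = reflectRow c (x (i + 2)) (x i) (x (i + 1)) :=
  Function.update_self _ _ _

/-- The sum over the rows of the number of entries `< j`, where the columns before `c` count in
full. -/
def maxSum (k : ℕ) (x : ℕ → ℕ → ℕ) (c j : ℕ) : ℕ := ∑ r ∈ range k, max (x j r) c

/-- The number of entries `< j`. -/
def rowSum (k : ℕ) (x : ℕ → ℕ → ℕ) (j : ℕ) : ℕ := ∑ r ∈ range k, x j r

theorem sum_min_add_maxSum (k : ℕ) (x : ℕ → ℕ → ℕ) (c j : ℕ) :
    ∑ r ∈ range k, min (x j r) c + maxSum k x c j = rowSum k x j + k * c := by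
  rw [maxSum, rowSum, ← sum_add_distrib, sum_congr rfl fun r _ => min_add_max (x j r) c,
    sum_add_distrib]
  simp

section bk

variable {k c i : ℕ} {e : ℕ → ℕ} {x : ℕ → ℕ → ℕ} (hx : IsGT k e x) (hi : i + 1 < k)
  (hc : ∀ r, c < x (i + 1) r → c < x i r)
include hx hi hc

theorem IsGT.bk : IsGT k e (bk c i x) := by
  have key := le_reflectRow (hx.inter (i + 1)) (hx.le (i + 1)) (hx.le i) (hx.inter i) hc
  have key2 := reflectRow_succ_le (hx.inter (i + 1)) (hx.le (i + 1)) (hx.le i) (hx.inter i) hc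
  refine ⟨fun r => ?_, fun j hj r => ?_, fun j r => ?_, fun j r => ?_⟩
  · rw [bk_of_ne _ (by omega), hx.zero]
  · rw [bk_of_ne _ (by omega), hx.top j hj]
  · by_cases h : j = i + 1
    · subst h
      rw [bk_self, bk_of_ne _ (by omega)]
      exact (key r).2.2
    by_cases h' : j = i
    · subst h'
      rw [bk_self, bk_of_ne _ (by omega)]
      exact (key r).2.1
    · rw [bk_of_ne _ h, bk_of_ne _ (by omega)]
      exact hx.le j r
  · by_cases h : j = i + 1
    · subst h
      rw [bk_self, bk_of_ne _ (by omega)]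
      exact (key r).1
    by_cases h' : j = i
    · subst h'
      rw [bk_self, bk_of_ne _ (by omega)]
      exact key2 r
    · rw [bk_of_ne _ h, bk_of_ne _ (by omega)]
      exact hx.inter j r

omit hi in
theorem bk_bk : KostkaLR.bk c i (KostkaLR.bk c i x) = x := by
  funext j r
  by_cases h : j = i + 1
  · subst h
    rw [bk_self, bk_self, bk_of_ne _ (by omega), bk_of_ne _ (by omega)]
    exact reflectRow_reflectRow (hx.inter (i + 1)) (hx.le (i + 1)) (hx.le i) (hx.inter i) hc r
  · rw [bk_of_ne _ h, bk_of_ne _ h]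

omit hi in
theorem maxSum_bk {d : ℕ} (hd : c ≤ d) (j : ℕ) :
    maxSum k (KostkaLR.bk c i x) d j = maxSum k x d j := by
  by_cases h : j = i + 1
  · subst h
    refine sum_congr rfl fun r _ => ?_
    rw [bk_self]
    exact max_reflectRow (hx.inter (i + 1)) (hx.le (i + 1)) (hx.le i) (hx.inter i) hc hd r
  · rw [maxSum, bk_of_ne _ h]; rfl

/-- In the columns before `c` the letters `i` and `i + 1` exchange multiplicities, and nothing moves
elsewhere. This is that exchange, free of subtraction, with capped sums expressed through `maxSum`.
-/
theorem rowSum_bk : rowSum k (KostkaLR.bk c i x) (i + 1) + rowSum k x (i + 1) +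
      maxSum k x c i + maxSum k x c (i + 2) =
    rowSum k x i + rowSum k x (i + 2) + 2 * maxSum k x c (i + 1) := by
  have h : ∑ r ∈ range k, min (KostkaLR.bk c i x (i + 1) r) c + ∑ r ∈ range k, min (x (i + 1) r) c =
      ∑ r ∈ range k, min (x (i + 2) r) c + ∑ r ∈ range k, min (x i r) c := by
    rw [bk_self]
    exact sum_min_reflectRow (hx.inter (i + 1)) (hx.le (i + 1)) (hx.le i) (hx.inter i) hc
      (hx.eq_zero (by omega))
  have a1 := sum_min_add_maxSum k x c i
  have a2 := sum_min_add_maxSum k x c (i + 1)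
  have a3 := sum_min_add_maxSum k x c (i + 2)
  have a4 := sum_min_add_maxSum k (KostkaLR.bk c i x) c (i + 1)
  rw [maxSum_bk hx hc le_rfl] at a4
  omega

end bk

/-! ### Weights and their symmetry. -/

section weight

variable {k : ℕ} {e : ℕ → ℕ} {x : ℕ → ℕ → ℕ}

/-- The weight of a pattern: the `i`-th entry is the number of letters `i`. -/
def gtWeight (k : ℕ) (x : ℕ → ℕ → ℕ) (i : Fin k) : ℕ := rowSum k x (i + 1) - rowSum k x i

theorem IsGT.gtWeight_add (hx : IsGT k e x) (i : Fin k) :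
    gtWeight k x i + rowSum k x i = rowSum k x (i + 1) :=
  Nat.sub_add_cancel (sum_le_sum fun r _ => hx.le i r)

theorem rowSum_bk_of_ne {c i j : ℕ} (h : j ≠ i + 1) : rowSum k (bk c i x) j = rowSum k x j := by
  rw [rowSum, bk_of_ne _ h]; rfl

/-- The effect of a Bender–Knuth reflection on a shifted weight. -/
theorem add_gtWeight_bk {c i : ℕ} (hx : IsGT k e x) (hi : i + 1 < k)
    (hc : ∀ r, c < x (i + 1) r → c < x i r) (b : Fin k → ℕ)
    (hb : b ⟨i, by omega⟩ + 2 * maxSum k x c (i + 1) =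
      b ⟨i + 1, hi⟩ + maxSum k x c (i + 2) + maxSum k x c i) :
    b + gtWeight k (bk c i x) =
      (b + gtWeight k x) ∘ Equiv.swap (⟨i, by omega⟩ : Fin k) ⟨i + 1, hi⟩ := by
  -- `hb` says that `b` plus the letters in the columns from `c` on has equal entries at `i` and `i
  -- + 1`. Exchanging the two letters in the remaining columns therefore swaps the total entries.
  have hx' := hx.bk hi hc
  have h := rowSum_bk hx hi hc
  have w1 := hx.gtWeight_add ⟨i, by omega⟩
  have w2 := hx.gtWeight_add ⟨i + 1, hi⟩
  have w3 := hx'.gtWeight_add ⟨i, by omega⟩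
  have w4 := hx'.gtWeight_add ⟨i + 1, hi⟩
  simp only at w1 w2 w3 w4
  rw [rowSum_bk_of_ne (by omega)] at w3
  rw [rowSum_bk_of_ne (j := i + 1 + 1) (by omega)] at w4
  rw [show i + 1 + 1 = i + 2 from rfl] at w2 w4
  funext j
  simp only [Pi.add_apply, Function.comp_apply]
  by_cases h1 : j = ⟨i, by omega⟩
  · subst h1
    rw [Equiv.swap_apply_left]
    omega
  by_cases h2 : j = ⟨i + 1, hi⟩
  · subst h2
    rw [Equiv.swap_apply_right]
    omega
  · rw [Equiv.swap_apply_of_ne_of_ne h1 h2]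
    have hj1 : (j : ℕ) ≠ i := fun h => h1 (Fin.ext h)
    have hj2 : (j : ℕ) ≠ i + 1 := fun h => h2 (Fin.ext h)
    rw [gtWeight, gtWeight, rowSum_bk_of_ne (by omega), rowSum_bk_of_ne (by omega)]

theorem IsGT.maxSum_eq (hx : IsGT k e x) {c : ℕ} (hc : e 0 ≤ c) (j : ℕ) :
    maxSum k x c j = k * c := by
  rw [maxSum, sum_congr rfl fun r _ => max_eq_right ((hx.le_top_zero j r).trans hc)]
  simp

/-- The cut-off `e 0` lies beyond every column, so this is the classical Bender–Knuth involution. -/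
theorem sum_gtSet_swap {A : Type*} [AddCommMonoid A] (f : (Fin k → ℕ) → A) {i : ℕ}
    (hi : i + 1 < k) :
    ∑ x ∈ gtSet k e, f (gtWeight k x ∘ Equiv.swap (⟨i, by omega⟩ : Fin k) ⟨i + 1, hi⟩) =
      ∑ x ∈ gtSet k e, f (gtWeight k x) := by
  have hc : ∀ x, IsGT k e x → ∀ r, e 0 < x (i + 1) r → e 0 < x i r := fun x hx r h =>
    absurd h (not_lt.2 (hx.le_top_zero _ _))
  refine sum_bij' (fun x _ => bk (e 0) i x) (fun x _ => bk (e 0) i x) ?_ ?_ ?_ ?_ ?_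
  · intro x hx
    rw [mem_gtSet] at hx ⊢
    exact hx.bk hi (hc x hx)
  · intro x hx
    rw [mem_gtSet] at hx ⊢
    exact hx.bk hi (hc x hx)
  · intro x hx
    rw [mem_gtSet] at hx
    exact bk_bk hx (hc x hx)
  · intro x hx
    rw [mem_gtSet] at hx
    exact bk_bk hx (hc x hx)
  · intro x hx
    rw [mem_gtSet] at hx
    have h := add_gtWeight_bk hx hi (hc x hx) 0 (by
      simp only [hx.maxSum_eq le_rfl, Pi.zero_apply]; omega)
    rw [zero_add, zero_add] at h
    rw [h]

theorem sum_gtSet_perm {A : Type*} [AddCommMonoid A] (f : (Fin k → ℕ) → A)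
    (σ : Equiv.Perm (Fin k)) :
    ∑ x ∈ gtSet k e, f (gtWeight k x ∘ σ) = ∑ x ∈ gtSet k e, f (gtWeight k x) := by
  cases k with
  | zero => rw [Subsingleton.elim σ 1]; rfl
  | succ n =>
    have hσ : σ ∈ Submonoid.closure
        (Set.range fun i : Fin n => Equiv.swap i.castSucc i.succ) := by
      rw [Equiv.Perm.mclosure_swap_castSucc_succ]; trivial
    induction hσ using Submonoid.closure_induction generalizing f with
    | mem τ hτ =>
      obtain ⟨i, rfl⟩ := hτ
      exact sum_gtSet_swap f (i := i) (by omega)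
    | one => rfl
    | mul τ ρ _ _ h1 h2 =>
      exact (h1 fun β => f (β ∘ ρ)).trans (h2 f)

/-- The number of semistandard tableaux of a given weight, as a number of patterns. -/
noncomputable def gtCount (k : ℕ) (e : ℕ → ℕ) (mu : Fin k → ℕ) : ℕ :=
  #{x ∈ gtSet k e | gtWeight k x = mu}

theorem gtCount_comp (mu : Fin k → ℕ) (σ : Equiv.Perm (Fin k)) :
    gtCount k e (mu ∘ σ) = gtCount k e mu := by
  classical
  simp only [gtCount, card_filter]
  rw [← sum_gtSet_perm (fun β => if β = mu ∘ σ then 1 else 0) σ]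
  refine sum_congr rfl fun x _ => ?_
  simp only [σ.surjective.injective_comp_right.eq_iff]

end weight

/-! ### The sign-reversing involution on non-dominant patterns. -/

section violation

variable {k : ℕ} {e l : ℕ → ℕ} {x : ℕ → ℕ → ℕ}

/-- For each `i`, among the letters in the columns from `c` on, the partition `l` together with
these letters has at least as many `i` as `i + 1`; here is the set of `i` where this fails. -/
def violations (k : ℕ) (l : ℕ → ℕ) (x : ℕ → ℕ → ℕ) (c : ℕ) : Set ℕ :=
  {i | i + 1 < k ∧ l i + 2 * maxSum k x c (i + 1) <
    l (i + 1) + maxSum k x c (i + 2) + maxSum k x c i}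

/-- Dominance with respect to `l` along the columns, read from right to left. -/
def ColDominant (k : ℕ) (l : ℕ → ℕ) (x : ℕ → ℕ → ℕ) : Prop := ∀ c, violations k l x c = ∅

theorem violations_of_le (hl : Antitone l) (hx : IsGT k e x) {c : ℕ} (hc : e 0 ≤ c) :
    violations k l x c = ∅ := by
  refine Set.eq_empty_of_forall_notMem fun i hi => ?_
  have h := hi.2
  have := hl (Nat.le_succ i)
  simp only [hx.maxSum_eq hc] at h
  simp only [Nat.succ_eq_add_one] at this
  omega

/-- The reflection moves nothing in the columns from `c` on. Hence the last violating column and its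
first letter survive, which makes `bkFirst` an involution. -/
theorem violations_bk {c d i : ℕ} (hx : IsGT k e x) (hc : ∀ r, c < x (i + 1) r → c < x i r)
    (hd : c ≤ d) : violations k l (bk c i x) d = violations k l x d := by
  simp only [violations, maxSum_bk hx hc hd]

/-- The correction term counts the entries `< j` in column `c`. -/
theorem maxSum_succ (x : ℕ → ℕ → ℕ) (c j : ℕ) :
    maxSum k x (c + 1) j + #{r ∈ range k | c < x j r} = maxSum k x c j + k := by
  have h : maxSum k x c j + k = ∑ r ∈ range k, (max (x j r) c + 1) := by
    simp [maxSum, sum_add_distrib]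
  rw [h, maxSum, card_filter, ← sum_add_distrib]
  refine sum_congr rfl fun r _ => ?_
  split_ifs <;> omega

/-- At the last column with a violation for `i`, there is no letter `i`, and the violation is by
exactly one. -/
theorem violation_aux (hx : IsGT k e x) {c i : ℕ} (h1 : i ∈ violations k l x c)
    (h2 : i ∉ violations k l x (c + 1)) :
    (∀ r, c < x (i + 1) r → c < x i r) ∧
      l i + 2 * maxSum k x c (i + 1) + 1 =
        l (i + 1) + maxSum k x c (i + 2) + maxSum k x c i := by
  have hi := h1.1
  have h2' : ¬ (l i + 2 * maxSum k x (c + 1) (i + 1) <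
    l (i + 1) + maxSum k x (c + 1) (i + 2) + maxSum k x (c + 1) i) := fun h => h2 ⟨hi, h⟩
  have h1' := h1.2
  have m0 := maxSum_succ (k := k) x c i
  have m1 := maxSum_succ (k := k) x c (i + 1)
  have m2 := maxSum_succ (k := k) x c (i + 2)
  have hsub : ({r ∈ range k | c < x i r}) ⊆ ({r ∈ range k | c < x (i + 1) r}) := fun r hr => by
    rw [mem_filter] at hr ⊢
    exact ⟨hr.1, hr.2.trans_le (hx.le i r)⟩
  have c1 := card_le_card hsub
  -- Column `c` contains at most one letter `i + 1`. As the violation arises in passing from `c + 1`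
  -- to `c`, that column must contain exactly one `i + 1` and no `i`.
  have c2 : #{r ∈ range k | c < x (i + 2) r} ≤ #{r ∈ range k | c < x (i + 1) r} + 1 := by
    have : ({r ∈ range k | c < x (i + 2) r}) ⊆
        insert 0 (({r ∈ range k | c < x (i + 1) r}).image Nat.succ) := fun r hr => by
      rw [mem_filter, mem_range] at hr
      cases r with
      | zero => exact mem_insert_self _ _
      | succ r =>
        refine mem_insert_of_mem (mem_image_of_mem _ (mem_filter.2 ⟨mem_range.2 (by omega), ?_⟩))
        exact hr.2.trans_le (hx.inter (i + 1) r)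
    exact (card_le_card this).trans ((card_insert_le _ _).trans
      (Nat.add_le_add_right card_image_le 1))
  refine ⟨fun r hr => ?_, by omega⟩
  have heq := eq_of_subset_of_card_le hsub (by omega)
  have hrk : r < k := by
    by_contra h
    rw [hx.eq_zero (by omega)] at hr
    omega
  have : r ∈ ({r ∈ range k | c < x (i + 1) r}) := mem_filter.2 ⟨mem_range.2 hrk, hr⟩
  rw [← heq] at this
  exact (mem_filter.1 this).2

open Classical in
/-- The last column with a violation. -/
noncomputable def lastColumn (k : ℕ) (e l : ℕ → ℕ) (x : ℕ → ℕ → ℕ) : ℕ :=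
  Nat.findGreatest (fun c => (violations k l x c).Nonempty) (e 0)

/-- The first violated letter at the last column with a violation. -/
noncomputable def firstLetter (k : ℕ) (e l : ℕ → ℕ) (x : ℕ → ℕ → ℕ) : ℕ :=
  sInf (violations k l x (lastColumn k e l x))

/-- The Bender–Knuth reflection at the first violation. -/
noncomputable def bkFirst (k : ℕ) (e l : ℕ → ℕ) (x : ℕ → ℕ → ℕ) : ℕ → ℕ → ℕ :=
  bk (lastColumn k e l x) (firstLetter k e l x) x

theorem lastColumn_spec (hl : Antitone l) (hx : IsGT k e x) (hd : ¬ ColDominant k l x) :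
    firstLetter k e l x ∈ violations k l x (lastColumn k e l x) ∧
      ∀ c, lastColumn k e l x < c → violations k l x c = ∅ := by
  classical
  simp only [ColDominant, not_forall, ← ne_eq, ← Set.nonempty_iff_ne_empty] at hd
  obtain ⟨c, hc⟩ := hd
  have hce : c ≤ e 0 := by
    by_contra h
    rw [violations_of_le hl hx (by omega)] at hc
    exact Set.not_nonempty_empty hc
  refine ⟨Nat.sInf_mem ?_, fun d hd => ?_⟩
  · have := Nat.findGreatest_spec (P := fun c => (violations k l x c).Nonempty) hce hc
    rw [lastColumn]
    convert this
  · by_cases hde : d ≤ e 0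
    · rw [← Set.not_nonempty_iff_eq_empty]
      exact Nat.findGreatest_is_greatest (P := fun c => (violations k l x c).Nonempty) hd hde
    · exact violations_of_le hl hx (by omega)

theorem lastColumn_congr {x x' : ℕ → ℕ → ℕ}
    (h : ∀ c, lastColumn k e l x ≤ c → violations k l x' c = violations k l x c) :
    lastColumn k e l x' = lastColumn k e l x := by
  classical
  have h' : Nat.findGreatest (fun c => (violations k l x c).Nonempty) (e 0) =
    lastColumn k e l x := rfl
  rw [Nat.findGreatest_eq_iff] at h'
  refine Nat.findGreatest_eq_iff.2 ⟨h'.1, fun h0 => ?_, fun n hn hn' => ?_⟩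
  · rw [h _ le_rfl]; exact h'.2.1 h0
  · rw [h _ hn.le]; exact h'.2.2 hn hn'

variable (hl : Antitone l) (hx : IsGT k e x) (hd : ¬ ColDominant k l x)
include hl hx hd

theorem lastColumn_hyp :
    (∀ r, lastColumn k e l x < x (firstLetter k e l x + 1) r →
      lastColumn k e l x < x (firstLetter k e l x) r) ∧
    l (firstLetter k e l x) + 2 * maxSum k x (lastColumn k e l x) (firstLetter k e l x + 1) + 1 =
      l (firstLetter k e l x + 1) +
        maxSum k x (lastColumn k e l x) (firstLetter k e l x + 2) +
        maxSum k x (lastColumn k e l x) (firstLetter k e l x) := by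
  have h := lastColumn_spec hl hx hd
  exact violation_aux hx h.1 (by rw [h.2 _ (Nat.lt_succ_self _)]; exact Set.notMem_empty _)

theorem lastColumn_bkFirst : lastColumn k e l (bkFirst k e l x) = lastColumn k e l x :=
  lastColumn_congr fun _ hc => violations_bk hx (lastColumn_hyp hl hx hd).1 hc

theorem firstLetter_bkFirst : firstLetter k e l (bkFirst k e l x) = firstLetter k e l x := by
  rw [firstLetter, lastColumn_bkFirst hl hx hd, bkFirst,
    violations_bk hx (lastColumn_hyp hl hx hd).1 le_rfl, firstLetter]

theorem bkFirst_bkFirst : bkFirst k e l (bkFirst k e l x) = x := by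
  rw [bkFirst, lastColumn_bkFirst hl hx hd, firstLetter_bkFirst hl hx hd, bkFirst,
    bk_bk hx (lastColumn_hyp hl hx hd).1]

theorem IsGT.bkFirst : IsGT k e (bkFirst k e l x) :=
  hx.bk (lastColumn_spec hl hx hd).1.1 (lastColumn_hyp hl hx hd).1

theorem not_colDominant_bkFirst : ¬ ColDominant k l (KostkaLR.bkFirst k e l x) := by
  intro h
  have h1 := (lastColumn_spec hl hx hd).1
  have h2 := h (lastColumn k e l x)
  rw [KostkaLR.bkFirst, violations_bk hx (lastColumn_hyp hl hx hd).1 le_rfl] at h2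
  rw [h2] at h1
  exact h1

/-- The staircase `(k - 1, …, 1, 0)`. -/
def staircase (k : ℕ) (i : Fin k) : ℕ := k - 1 - i

/-- The staircase drops by one at each step and so turns a violation by exactly one into the
equality that `add_gtWeight_bk` needs. -/
theorem exists_swap_bkFirst : ∃ a b : Fin k, a ≠ b ∧
    (fun i : Fin k => l i) + staircase k + gtWeight k (KostkaLR.bkFirst k e l x) =
      ((fun i : Fin k => l i) + staircase k + gtWeight k x) ∘ Equiv.swap a b := by
  have hi := (lastColumn_spec hl hx hd).1.1
  have h := lastColumn_hyp hl hx hd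
  refine ⟨⟨firstLetter k e l x, by omega⟩, ⟨firstLetter k e l x + 1, hi⟩, ?_, ?_⟩
  · simp [Fin.ext_iff]
  · refine add_gtWeight_bk hx hi h.1 _ ?_
    simp only [Pi.add_apply, staircase]
    omega

end violation

/-! ### Column dominance equals row dominance; the highest-weight pattern. -/

section dominance

variable {k : ℕ} {e l : ℕ → ℕ} {x : ℕ → ℕ → ℕ}

/-- The number of entries `< j` in the first `a` rows. -/
def headSum (x : ℕ → ℕ → ℕ) (j a : ℕ) : ℕ := ∑ r ∈ range a, x j r

theorem headSum_succ (x : ℕ → ℕ → ℕ) (j a : ℕ) : headSum x j (a + 1) = headSum x j a + x j a :=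
  sum_range_succ _ _

/-- Dominance with respect to `l` along the rows, read from top to bottom and from right to left. -/
def RowDominant (k : ℕ) (l : ℕ → ℕ) (x : ℕ → ℕ → ℕ) : Prop :=
  ∀ i, i + 1 < k → ∀ a, l (i + 1) + headSum x (i + 2) (a + 1) + headSum x i a ≤
    l i + headSum x (i + 1) (a + 1) + headSum x (i + 1) a

theorem IsGT.eq_zero_of_le (hx : IsGT k e x) {j r : ℕ} (hr : k ≤ r) : x j r = 0 := by
  by_cases hj : j ≤ k
  · exact hx.eq_zero (hj.trans hr)
  · rw [hx.top j (by omega), ← hx.top k le_rfl]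
    exact hx.eq_zero hr

theorem IsGT.headSum_eq (hx : IsGT k e x) (j a : ℕ) :
    headSum x j a = ∑ r ∈ range k, if r < a then x j r else 0 := by
  rw [← sum_filter, headSum]
  symm
  refine sum_subset (fun r hr => ?_) (fun r hr hr' => ?_)
  · simp only [mem_filter, mem_range] at hr ⊢
    exact hr.2
  · simp only [mem_filter, mem_range, not_and'] at hr hr'
    exact hx.eq_zero_of_le (not_lt.1 (hr' hr))

theorem ColDominant.rowDominant (hx : IsGT k e x) (h : ColDominant k l x) :
    RowDominant k l x := by
  intro i hi a
  -- At this cut-off, the letters `i + 1` of the first `a + 1` rows all lie in the columns counted,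
  -- while the counted letters `i` all lie in the first `a` rows.
  have hc : i ∉ violations k l x (x (i + 1) a) := by rw [h]; exact Set.notMem_empty _
  have hc' := not_lt.1 fun h => hc ⟨hi, h⟩
  have key : headSum x (i + 2) (a + 1) + headSum x i a + 2 * maxSum k x (x (i + 1) a) (i + 1) ≤
      maxSum k x (x (i + 1) a) (i + 2) + maxSum k x (x (i + 1) a) i +
        headSum x (i + 1) (a + 1) + headSum x (i + 1) a := by
    simp only [hx.headSum_eq, maxSum, mul_sum, ← sum_add_distrib]
    refine sum_le_sum fun r _ => ?_
    have h1 := hx.le (i + 1) r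
    have h2 := hx.le i r
    have h1' : x (i + 1) r ≤ x (i + 2) r := h1
    rcases lt_trichotomy r a with hr | rfl | hr
    · have h3 := hx.anti (i + 1) (show r + 1 ≤ a from hr)
      have h4 := hx.inter i r
      rw [if_pos (by omega), if_pos (by omega), if_pos (by omega), if_pos (by omega)]
      omega
    · rw [if_pos (by omega), if_neg (by omega), if_pos (by omega), if_neg (by omega)]
      omega
    · have h3 := hx.anti (i + 1) hr.le
      rw [if_neg (by omega), if_neg (by omega), if_neg (by omega), if_neg (by omega)]
      omega
  omega

theorem RowDominant.colDominant (hl : Antitone l) (hx : IsGT k e x) (h : RowDominant k l x) :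
    ColDominant k l x := by
  intro c
  refine Set.eq_empty_of_forall_notMem fun i hi => ?_
  obtain ⟨hik, hlt⟩ := hi
  -- The first such row `n` is the number of entries at most `i + 1` in column `c`; letters `i + 1`
  -- in the columns from `c` on occur only in rows before `n`.
  have hex : ∃ r, x (i + 2) r ≤ c := ⟨k, by rw [hx.eq_zero_of_le le_rfl]; exact Nat.zero_le _⟩
  have hn := Nat.find_spec hex
  have hn' : ∀ r < Nat.find hex, c < x (i + 2) r := fun r hr => not_le.1 (Nat.find_min hex hr)
  have hn2 : ∀ r, Nat.find hex ≤ r → x (i + 2) r ≤ c := fun r hr => (hx.anti _ hr).trans hn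
  generalize Nat.find hex = n at hn hn' hn2
  have ha : ∀ r, x (i + 1) r ≤ x (i + 2) r := hx.le (i + 1)
  have hb := hx.le i
  have hp : ∀ r, x (i + 2) (r + 1) ≤ x (i + 1) r := hx.inter (i + 1)
  have hq := hx.inter i
  cases n with
  | zero =>
    have e1 : maxSum k x c (i + 2) + maxSum k x c i ≤ 2 * maxSum k x c (i + 1) := by
      simp only [maxSum, mul_sum, ← sum_add_distrib]
      refine sum_le_sum fun r _ => ?_
      have := hn2 r (Nat.zero_le _)
      have := ha r
      have := hb r
      omega
    have := hl (Nat.le_succ i)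
    simp only [Nat.succ_eq_add_one] at this
    omega
  | succ a =>
    by_cases hcase : ∀ b, b + 1 = a → c ≤ x i b
    -- Here the letters `i` of the first `a` rows all lie in the columns from `c` on, so row
    -- dominance at `a` suffices.
    · have hd := h i hik a
      have key : maxSum k x c (i + 2) + maxSum k x c i + headSum x (i + 1) (a + 1) +
          headSum x (i + 1) a ≤ headSum x (i + 2) (a + 1) + headSum x i a +
            2 * maxSum k x c (i + 1) := by
        simp only [hx.headSum_eq, maxSum, mul_sum, ← sum_add_distrib]
        refine sum_le_sum fun r _ => ?_
        have h1 := ha r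
        have h2 := hb r
        have h3 := hp r
        have h4 := hq r
        rcases lt_trichotomy r a with hr | rfl | hr
        · have h5 := hn' (r + 1) (by omega)
          have h6 : c ≤ x i r := by
            by_cases hra : r + 1 = a
            · exact hcase r hra
            · have := hn' (r + 1 + 1) (by omega)
              have := hp (r + 1)
              omega
          rw [if_pos (by omega), if_pos (by omega), if_pos (by omega), if_pos (by omega)]
          omega
        · have h5 := hn' r (by omega)
          rw [if_pos (by omega), if_neg (by omega), if_pos (by omega), if_neg (by omega)]
          omega
        · have h5 := hn2 r hr
          rw [if_neg (by omega), if_neg (by omega), if_neg (by omega), if_neg (by omega)]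
          omega
      omega
    · push Not at hcase
      obtain ⟨b, rfl, hbc⟩ := hcase
      -- Row dominance is used one row higher. From column `c` on, row `b + 1` has `x (i + 2) (b +
      -- 1) - c` letters `i + 1`, and row `b` has at least as many letters `i`. The indicator sums
      -- in `key` transfer this number from row `b + 1` to row `b`.
      have hd := h i hik b
      have hbk : b + 1 < k := by
        by_contra hk
        have := hn' (b + 1) (by omega)
        rw [hx.eq_zero_of_le (by omega)] at this
        omega
      have key : maxSum k x c (i + 2) + maxSum k x c i + headSum x (i + 1) (b + 1) +
          headSum x (i + 1) b + (∑ r ∈ range k, if r = b then x (i + 2) (b + 1) else 0) +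
          (∑ r ∈ range k, if r = b + 1 then c else 0) ≤
            headSum x (i + 2) (b + 1) + headSum x i b + 2 * maxSum k x c (i + 1) +
            (∑ r ∈ range k, if r = b + 1 then x (i + 2) (b + 1) else 0) +
            (∑ r ∈ range k, if r = b then c else 0) := by
        simp only [hx.headSum_eq, maxSum, mul_sum, ← sum_add_distrib]
        refine sum_le_sum fun r _ => ?_
        have h1 := ha r
        have h2 := hb r
        have h3 := hp r
        have h4 := hq r
        rcases lt_trichotomy r b with hr | rfl | hr
        · have h5 := hn' (r + 1 + 1) (by omega)
          have := hp (r + 1)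
          rw [if_pos (by omega), if_pos (by omega), if_neg (by omega), if_neg (by omega),
            if_pos (by omega), if_pos (by omega), if_neg (by omega), if_neg (by omega)]
          omega
        · have h5 := hn' (r + 1) (by omega)
          rw [if_pos (by omega), if_neg (by omega), if_pos rfl, if_neg (by omega),
            if_pos (by omega), if_neg (by omega), if_neg (by omega), if_pos rfl]
          omega
        · simp only [if_neg (show ¬ r < b + 1 by omega), if_neg (show ¬ r < b by omega),
            if_neg (show ¬ r = b by omega)]
          by_cases hrb : r = b + 1
          · subst hrb
            have h5 := hn' (b + 1) (by omega)
            have := ha (b + 1)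
            have := hb (b + 1)
            simp only [if_true]
            have := hq b
            omega
          · have h5 := hn2 r (by omega)
            simp only [if_neg hrb]
            omega
      rw [sum_ite_eq_of_mem' _ _ _ (mem_range.2 (by omega)),
        sum_ite_eq_of_mem' _ _ _ (mem_range.2 (by omega)),
        sum_ite_eq_of_mem' _ _ _ (mem_range.2 (by omega)),
        sum_ite_eq_of_mem' _ _ _ (mem_range.2 (by omega))] at key
      omega

theorem colDominant_iff (hl : Antitone l) (hx : IsGT k e x) :
    ColDominant k l x ↔ RowDominant k l x :=
  ⟨fun h => h.rowDominant hx, fun h => h.colDominant hl hx⟩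

/-- The pattern of the tableau whose `r`-th row consists of letters `r`. -/
def highest (e : ℕ → ℕ) (j r : ℕ) : ℕ := if r < j then e r else 0

theorem isGT_highest (he : Antitone e) (hk : ∀ r, k ≤ r → e r = 0) : IsGT k e (highest e) := by
  refine ⟨fun r => by simp [highest], fun j hj r => ?_, fun j r => ?_, fun j r => ?_⟩ <;>
    simp only [highest]
  · split_ifs with h
    · rfl
    · exact (hk r (by omega)).symm
  · split_ifs <;> omega
  · have : e (r + 1) ≤ e r := he (Nat.le_succ r)
    split_ifs <;> omega

theorem headSum_highest (j a : ℕ) : headSum (highest e) j a = ∑ r ∈ range (min a j), e r := by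
  simp only [headSum, highest]
  rw [← sum_filter]
  congr 1
  ext r
  simp

theorem rowDominant_highest (he : Antitone e) : RowDominant k 0 (highest e) := by
  intro i hi a
  simp only [headSum_highest, Pi.zero_apply]
  by_cases h : a ≤ i
  · rw [min_eq_left (by omega), min_eq_left (by omega), min_eq_left (by omega),
      min_eq_left (by omega)]
  · rw [min_eq_right (by omega), min_eq_right (by omega), min_eq_right (by omega),
      min_eq_right (by omega), sum_range_succ _ (i + 1), sum_range_succ _ i]
    have : e (i + 1) ≤ e i := he (Nat.le_succ i)
    omega

/-- No letter exceeds its row index: by dominance, the letters `i + 1` in the first `a + 1` rows are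
at most the letters `i` in the first `a` rows, and for `a ≤ i` there are none of the latter by
induction on `a`. -/
theorem RowDominant.eq_highest (hx : IsGT k e x) (h : RowDominant k 0 x) : x = highest e := by
  have key : ∀ a i, a ≤ i → i + 1 < k → x (i + 2) a = x (i + 1) a := by
    intro a
    induction a using Nat.strong_induction_on with
    | _ a ih =>
      intro i hai hi
      have h1 := h i hi a
      simp only [headSum_succ, Pi.zero_apply] at h1
      have e1 : headSum x (i + 2) a = headSum x (i + 1) a :=
        sum_congr rfl fun r hr => ih r (mem_range.1 hr) i (by have := mem_range.1 hr; omega) hi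
      have e2 : headSum x (i + 1) a = headSum x i a := sum_congr rfl fun r hr => by
        have hr := mem_range.1 hr
        obtain ⟨i, rfl⟩ : ∃ i', i = i' + 1 := ⟨i - 1, by omega⟩
        exact ih r hr i (by omega) (by omega)
      have : x (i + 1) a ≤ x (i + 2) a := hx.le (i + 1) a
      omega
  have key2 : ∀ d a, a + 1 + d ≤ k → x (a + 1 + d) a = x (a + 1) a := by
    intro d a
    induction d with
    | zero => intro _; rfl
    | succ d ih =>
      intro hd
      rw [← ih (by omega), show a + 1 + (d + 1) = a + d + 2 by omega,
        show a + 1 + d = a + d + 1 by omega]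
      exact key a (a + d) (by omega) (by omega)
  funext j r
  rw [highest]
  split_ifs with hr
  · by_cases hj : k ≤ j
    · exact hx.top j hj r
    · have h1 := key2 (j - (r + 1)) r (by omega)
      have h2 := key2 (k - (r + 1)) r (by omega)
      rw [show r + 1 + (j - (r + 1)) = j by omega] at h1
      rw [show r + 1 + (k - (r + 1)) = k by omega, hx.top k le_rfl] at h2
      omega
  · exact hx.eq_zero (by omega)

theorem gtWeight_highest (i : Fin k) : gtWeight k (highest e) i = e i := by
  have h : ∀ j ≤ k, rowSum k (highest e) j = ∑ r ∈ range j, e r := fun j hj => by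
    have := headSum_highest (e := e) j k
    rw [min_eq_right hj] at this
    exact this
  rw [gtWeight, h _ i.2, h _ i.2.le, sum_range_succ]
  omega

end dominance

/-! ### Schur polynomials, alternants and comparison of coefficients. -/

section polynomial

variable {k : ℕ} {e l : ℕ → ℕ}

/-- The monomial with a given exponent vector. -/
noncomputable def mon (α : Fin k → ℕ) : MvPolynomial (Fin k) ℤ :=
  MvPolynomial.monomial (Finsupp.equivFunOnFinite.symm α) 1

theorem mon_mul_mon (α β : Fin k → ℕ) : mon α * mon β = mon (α + β) := by
  rw [mon, mon, mon, MvPolynomial.monomial_mul, one_mul]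
  exact congrArg (fun s => MvPolynomial.monomial s 1) (Finsupp.ext fun i => rfl)

/-- The coefficient of the monomial with a given exponent vector. -/
noncomputable def coeffAt (β : Fin k → ℕ) : MvPolynomial (Fin k) ℤ →ₗ[ℤ] ℤ :=
  MvPolynomial.lcoeff ℤ (Finsupp.equivFunOnFinite.symm β)

theorem coeffAt_mon (α β : Fin k → ℕ) : coeffAt β (mon α) = if α = β then 1 else 0 := by
  classical
  rw [coeffAt, mon, MvPolynomial.lcoeff_apply, MvPolynomial.coeff_monomial]
  simp only [EmbeddingLike.apply_eq_iff_eq]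

/-- The alternant with a given exponent vector. -/
noncomputable def alternant (α : Fin k → ℕ) : MvPolynomial (Fin k) ℤ :=
  ∑ σ : Equiv.Perm (Fin k), (Equiv.Perm.sign σ : ℤ) • mon (α ∘ σ)

theorem alternant_comp (α : Fin k → ℕ) (τ : Equiv.Perm (Fin k)) :
    alternant (α ∘ τ) = (Equiv.Perm.sign τ : ℤ) • alternant α := by
  rw [alternant, alternant, smul_sum]
  symm
  rw [← Equiv.sum_comp (Equiv.mulLeft τ)]
  refine sum_congr rfl fun σ _ => ?_
  have h : (Equiv.Perm.sign τ : ℤ) * Equiv.Perm.sign τ = 1 := by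
    rw [← Units.val_mul, Int.units_mul_self, Units.val_one]
  rw [Equiv.coe_mulLeft, Equiv.Perm.sign_mul, smul_smul, Units.val_mul, ← mul_assoc, h, one_mul]
  rfl

theorem eq_one_of_strictAnti {α : Fin k → ℕ} {σ : Equiv.Perm (Fin k)} (h : StrictAnti α)
    (h' : StrictAnti (α ∘ σ)) : σ = 1 := by
  have hσ : StrictMono σ := fun i j hij => h.lt_iff_gt.1 (h' hij)
  refine Equiv.ext fun i => congrFun ((hσ.range_inj strictMono_id).1 ?_) i
  rw [σ.surjective.range_eq, Set.range_id]

theorem coeffAt_alternant {α β : Fin k → ℕ} (hα : StrictAnti α) (hβ : StrictAnti β) :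
    coeffAt β (alternant α) = if α = β then 1 else 0 := by
  rw [alternant, map_sum, sum_eq_single 1]
  · simp only [coeffAt_mon, Equiv.Perm.sign_one, Units.val_one, one_smul]
    rfl
  · intro σ _ hσ
    rw [map_smul, coeffAt_mon, if_neg, smul_zero]
    rintro rfl
    exact hσ (eq_one_of_strictAnti hα hβ)
  · simp

/-- The Schur polynomial as a sum over patterns. -/
noncomputable def schur (k : ℕ) (e : ℕ → ℕ) : MvPolynomial (Fin k) ℤ :=
  ∑ x ∈ gtSet k e, mon (gtWeight k x)

/-- For each term of the alternant, the symmetry of the weights lets the same `σ` act on the weight.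
-/
theorem schur_mul_alternant (e : ℕ → ℕ) (α : Fin k → ℕ) :
    schur k e * alternant α = ∑ x ∈ gtSet k e, alternant (α + gtWeight k x) := by
  simp only [alternant]
  rw [sum_comm, mul_sum]
  refine sum_congr rfl fun σ _ => ?_
  rw [mul_smul_comm, schur, sum_mul, ← smul_sum]
  congr 1
  rw [← sum_gtSet_perm (fun β => mon β * mon (α ∘ σ)) σ]
  refine sum_congr rfl fun x _ => ?_
  rw [mon_mul_mon, add_comm]
  rfl

open Classical in
/-- Multiplication of an alternant by a Schur polynomial: only dominant patterns survive. -/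
theorem schur_mul_alternant_dominant (hl : Antitone l) :
    schur k e * alternant ((fun i : Fin k => l i) + staircase k) =
      ∑ x ∈ gtSet k e with ColDominant k l x,
        alternant ((fun i : Fin k => l i) + staircase k + gtWeight k x) := by
  rw [schur_mul_alternant, ← sum_filter_add_sum_filter_not (gtSet k e) (ColDominant k l),
    add_eq_left]
  have key : ∀ x ∈ gtSet k e, ¬ ColDominant k l x →
      alternant ((fun i : Fin k => l i) + staircase k + gtWeight k x) +
        alternant ((fun i : Fin k => l i) + staircase k + gtWeight k (bkFirst k e l x)) = 0 := by
    intro x hx hd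
    obtain ⟨a, b, hab, h⟩ := exists_swap_bkFirst hl (mem_gtSet.1 hx) hd
    rw [h, alternant_comp, Equiv.Perm.sign_swap hab]
    simp
  refine sum_involution (fun x _ => bkFirst k e l x) ?_ ?_ ?_ ?_
  · intro x hx
    exact key x (mem_filter.1 hx).1 (mem_filter.1 hx).2
  · intro x hx hne heq
    have h := key x (mem_filter.1 hx).1 (mem_filter.1 hx).2
    -- At a fixed point the cancellation reads 2a = 0, so the alternant itself vanishes.
    rw [heq, ← two_mul, mul_eq_zero] at h
    exact hne (h.resolve_left two_ne_zero)
  · intro x hx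
    obtain ⟨hx, hd⟩ := mem_filter.1 hx
    rw [mem_gtSet] at hx
    exact mem_filter.2 ⟨mem_gtSet.2 (hx.bkFirst hl hd), not_colDominant_bkFirst hl hx hd⟩
  · intro x hx
    obtain ⟨hx, hd⟩ := mem_filter.1 hx
    exact bkFirst_bkFirst hl (mem_gtSet.1 hx) hd

/-- The bialternant formula. -/
theorem schur_mul_alternant_staircase (he : Antitone e) (hk : ∀ r, k ≤ r → e r = 0) :
    schur k e * alternant (staircase k) = alternant ((fun i : Fin k => e i) + staircase k) := by
  classical
  have h0 : Antitone (0 : ℕ → ℕ) := fun _ _ _ => le_rfl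
  have h := schur_mul_alternant_dominant (k := k) (e := e) h0
  have hz : (fun i : Fin k => (0 : ℕ → ℕ) i) = 0 := rfl
  have hs : ({x ∈ gtSet k e | ColDominant k 0 x}) = {highest e} := by
    ext x
    rw [mem_filter, mem_gtSet, mem_singleton]
    constructor
    · rintro ⟨hx, hd⟩
      exact (hd.rowDominant hx).eq_highest hx
    · rintro rfl
      exact ⟨isGT_highest he hk,
        (rowDominant_highest he).colDominant h0 (isGT_highest he hk)⟩
  rw [hs, sum_singleton, hz, zero_add] at h
  rw [h, add_comm]
  congr 2
  funext i
  exact gtWeight_highest i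

theorem schur_mul_alternant_comm (hl : Antitone l) (hlk : ∀ r, k ≤ r → l r = 0)
    (he : Antitone e) (hk : ∀ r, k ≤ r → e r = 0) :
    schur k l * alternant ((fun i : Fin k => e i) + staircase k) =
      schur k e * alternant ((fun i : Fin k => l i) + staircase k) := by
  rw [← schur_mul_alternant_staircase he hk, ← schur_mul_alternant_staircase hl hlk,
    mul_left_comm]

theorem strictAnti_add_staircase {f : Fin k → ℕ} (hf : Antitone f) :
    StrictAnti (f + staircase k) := by
  intro i j hij
  have h1 := hf hij.le
  have h2 := j.2
  have h3 : (i : ℕ) < j := hij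
  simp only [Pi.add_apply, staircase]
  omega

theorem ColDominant.antitone {x : ℕ → ℕ → ℕ} (hx : IsGT k e x) (hd : ColDominant k l x) :
    Antitone ((fun i : Fin k => l i) + gtWeight k x) := by
  cases k with
  | zero => exact fun i => i.elim0
  | succ n =>
    rw [Fin.antitone_iff_succ_le]
    intro i
    -- With cut-off `0` every letter counts.
    have hi : (i : ℕ) ∉ violations (n + 1) l x 0 := by rw [hd]; exact Set.notMem_empty _
    have hi' := not_lt.1 fun h => hi ⟨by omega, h⟩
    have h1 := hx.gtWeight_add i.castSucc
    have h2 := hx.gtWeight_add i.succ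
    have hm : ∀ j, maxSum (n + 1) x 0 j = rowSum (n + 1) x j := fun j => by
      simp [maxSum, rowSum]
    simp only [hm] at hi'
    simp only [Pi.add_apply, Fin.val_succ, Fin.val_castSucc] at h1 h2 ⊢
    rw [show (i : ℕ) + 1 + 1 = i + 2 from rfl] at h2
    omega

open Classical in
/-- The signed sum of weight multiplicities counts dominant patterns. -/
theorem sum_sign_gtCount (hl : Antitone l) (hlk : ∀ r, k ≤ r → l r = 0)
    (he : Antitone e) (hk : ∀ r, k ≤ r → e r = 0) {g : Fin k → ℕ} (hg : Antitone g) :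
    (∑ σ : Equiv.Perm (Fin k), (Equiv.Perm.sign σ : ℤ) *
      if ((fun i : Fin k => e i) + staircase k) ∘ σ ≤ g + staircase k then
        (gtCount k l (g + staircase k - ((fun i : Fin k => e i) + staircase k) ∘ σ) : ℤ) else 0) =
    (#{x ∈ gtSet k e | RowDominant k l x ∧ (fun i : Fin k => l i) + gtWeight k x = g} : ℤ) := by
  -- Compare coefficients of x^(g+ρ): the left side gives the signed sum; on the right, all
  -- exponents are strictly decreasing, so each alternant contributes 1 or 0.
  have h := congrArg (coeffAt (g + staircase k)) (schur_mul_alternant_comm hl hlk he hk)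
  rw [schur_mul_alternant_dominant hl, map_sum] at h
  have hr : ∀ x ∈ ({x ∈ gtSet k e | ColDominant k l x}),
      coeffAt (g + staircase k)
        (alternant ((fun i : Fin k => l i) + staircase k + gtWeight k x)) =
      if (fun i : Fin k => l i) + gtWeight k x = g then 1 else 0 := by
    intro x hx
    obtain ⟨hx, hd⟩ := mem_filter.1 hx
    rw [add_right_comm, coeffAt_alternant
      (strictAnti_add_staircase (hd.antitone (mem_gtSet.1 hx))) (strictAnti_add_staircase hg)]
    simp only [add_left_inj]
  rw [sum_congr rfl hr, ← sum_filter, filter_filter, sum_const, nsmul_eq_mul, mul_one] at h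
  have hf : ({x ∈ gtSet k e | RowDominant k l x ∧ (fun i : Fin k => l i) + gtWeight k x = g}) =
      ({x ∈ gtSet k e | ColDominant k l x ∧ (fun i : Fin k => l i) + gtWeight k x = g}) :=
    filter_congr fun x hx => by rw [colDominant_iff hl (mem_gtSet.1 hx)]
  rw [hf, ← h, alternant, mul_sum, map_sum]
  refine sum_congr rfl fun σ _ => ?_
  rw [mul_smul_comm, map_smul, smul_eq_mul]
  congr 1
  simp only [schur, sum_mul, map_sum, mon_mul_mon, coeffAt_mon]
  split_ifs with hle
  · rw [gtCount, card_filter]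
    push_cast
    refine sum_congr rfl fun x _ => ?_
    congr 1
    rw [eq_iff_iff]
    constructor
    · rintro h
      rw [h, tsub_add_cancel_of_le hle]
    · rintro h
      rw [← h, add_tsub_cancel_right]
  · refine (sum_eq_zero fun x _ => if_neg fun h => hle ?_).symm
    rw [← h]
    exact le_add_self

end polynomial

/-! ### Semistandard fillings as chains of horizontal strips. -/

section filling

variable {k : ℕ} {l g : ℕ → ℕ} {T y : ℕ → ℕ → ℕ}

/-- Semistandard fillings, with letters `0, …, k - 1`, of the boxes `(i, j)` with
`l i ≤ j < g i`. -/
structure IsFilling (k : ℕ) (l g : ℕ → ℕ) (T : ℕ → ℕ → ℕ) : Prop where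
  row : ∀ i j1 j2, j1 < j2 → l i ≤ j1 → j2 < g i → T i j1 ≤ T i j2
  col : ∀ i1 i2 j, i1 < i2 → l i1 ≤ j → j < g i1 → l i2 ≤ j → j < g i2 → T i1 j < T i2 j
  zero : ∀ i j, ¬ (l i ≤ j ∧ j < g i) → T i j = 0
  lt : ∀ i j, l i ≤ j → j < g i → T i j < k

/-- Chains of horizontal strips from `l` to `g`: `y i a` is the length of row `i` of the `a`-th
member of the chain. -/
structure IsStripChain (k : ℕ) (l g : ℕ → ℕ) (y : ℕ → ℕ → ℕ) : Prop where
  bot : ∀ i, y i 0 = l i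
  top : ∀ i a, k ≤ a → y i a = g i
  le : ∀ i a, y i a ≤ y i (a + 1)
  inter : ∀ i a, y (i + 1) (a + 1) ≤ y i a

theorem IsStripChain.mono (h : IsStripChain k l g y) (i : ℕ) : Monotone (y i) :=
  monotone_nat_of_le_succ (h.le i)

theorem IsStripChain.bot_le (h : IsStripChain k l g y) (i a : ℕ) : l i ≤ y i a := by
  rw [← h.bot]; exact h.mono i (Nat.zero_le a)

theorem IsStripChain.le_top (h : IsStripChain k l g y) (i a : ℕ) : y i a ≤ g i := by
  rw [← h.top i (max a k) (le_max_right _ _)]; exact h.mono i (le_max_left _ _)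

/-- The chain of shapes of a filling. -/
def toChain (l g : ℕ → ℕ) (T : ℕ → ℕ → ℕ) (i a : ℕ) : ℕ :=
  l i + #{j ∈ Ico (l i) (g i) | T i j < a}

/-- The filling of a chain of shapes. -/
noncomputable def toFilling (l g : ℕ → ℕ) (y : ℕ → ℕ → ℕ) (i j : ℕ) : ℕ :=
  if l i ≤ j ∧ j < g i then sInf {a | j < y i (a + 1)} else 0

/-- Rows increase weakly, so the entries `< a` of a row form an initial segment. This equivalence is
the only link between fillings and chains used later on. -/
theorem IsFilling.lt_iff (h : IsFilling k l g T) {i j : ℕ} (h1 : l i ≤ j) (h2 : j < g i) (a : ℕ) :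
    T i j < a ↔ j < toChain l g T i a := by
  constructor
  · intro ha
    have hs : Ico (l i) (j + 1) ⊆ {j ∈ Ico (l i) (g i) | T i j < a} := fun j' hj' => by
      rw [mem_Ico] at hj'
      rw [mem_filter, mem_Ico]
      refine ⟨⟨hj'.1, by omega⟩, ?_⟩
      rcases (Nat.lt_succ_iff.1 hj'.2).lt_or_eq with hlt | rfl
      · exact (h.row i j' j hlt hj'.1 h2).trans_lt ha
      · exact ha
    have := card_le_card hs
    rw [Nat.card_Ico] at this
    rw [toChain]
    omega
  · intro hj
    by_contra ha
    have hs : ({j ∈ Ico (l i) (g i) | T i j < a}) ⊆ Ico (l i) j := fun j' hj' => by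
      rw [mem_filter, mem_Ico] at hj'
      rw [mem_Ico]
      refine ⟨hj'.1.1, ?_⟩
      by_contra hle
      rcases (not_lt.1 hle).lt_or_eq with hlt | rfl
      · exact ha ((h.row i j j' hlt h1 hj'.1.2).trans_lt hj'.2)
      · exact ha hj'.2
    have := card_le_card hs
    rw [Nat.card_Ico] at this
    rw [toChain] at hj
    omega

theorem toFilling_lt_iff (h : IsStripChain k l g y) {i j : ℕ} (h1 : l i ≤ j) (h2 : j < g i)
    (a : ℕ) : toFilling l g y i j < a ↔ j < y i a := by
  rw [toFilling, if_pos ⟨h1, h2⟩]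
  cases a with
  | zero => rw [h.bot]; omega
  | succ a =>
    rw [Nat.lt_succ_iff]
    constructor
    · intro ha
      have hne : {a | j < y i (a + 1)}.Nonempty := ⟨k, by
        rw [Set.mem_ofPred_eq, h.top i _ (Nat.le_succ k)]; exact h2⟩
      have hm : j < y i (sInf {a | j < y i (a + 1)} + 1) := Nat.sInf_mem hne
      exact hm.trans_le (h.mono i (Nat.succ_le_succ ha))
    · intro hj
      exact Nat.sInf_le hj

theorem toChain_le_top (hlg : l ≤ g) (i a : ℕ) : toChain l g T i a ≤ g i := by
  have h1 : #{j ∈ Ico (l i) (g i) | T i j < a} ≤ #(Ico (l i) (g i)) := card_filter_le _ _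
  rw [Nat.card_Ico] at h1
  have h2 : l i ≤ g i := hlg i
  rw [toChain]
  omega

theorem IsFilling.toChain (hl : Antitone l) (hg : Antitone g) (hlg : l ≤ g)
    (h : IsFilling k l g T) : IsStripChain k l g (toChain l g T) := by
  refine ⟨fun i => by simp [KostkaLR.toChain], fun i a ha => ?_, fun i a => ?_, fun i a => ?_⟩
  · rw [KostkaLR.toChain, filter_true_of_mem, Nat.card_Ico]
    · exact Nat.add_sub_cancel' (hlg i)
    · intro j hj
      rw [mem_Ico] at hj
      exact (h.lt i j hj.1 hj.2).trans_le ha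
  · refine Nat.add_le_add_left (card_le_card fun j hj => ?_) _
    rw [mem_filter] at hj ⊢
    exact ⟨hj.1, hj.2.trans (Nat.lt_succ_self a)⟩
  · refine le_of_forall_lt fun j hj => ?_
    by_cases hj1 : j < l i
    · exact hj1.trans_le (Nat.le_add_right _ _)
    · have h1 := hl (Nat.le_succ i)
      have h2 := hg (Nat.le_succ i)
      have h3 := toChain_le_top (T := T) hlg (i + 1) (a + 1)
      simp only [Nat.succ_eq_add_one] at h1 h2
      have h4 : j < g (i + 1) := hj.trans_le h3
      rw [← h.lt_iff (by omega) (by omega)] at hj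
      rw [← h.lt_iff (by omega) (by omega)]
      have := h.col i (i + 1) j (Nat.lt_succ_self i) (by omega) (by omega) (by omega) (by omega)
      omega

theorem IsStripChain.toFilling (h : IsStripChain k l g y) :
    IsFilling k l g (toFilling l g y) := by
  have hcol : ∀ d i a, y (i + 1 + d) (a + 1) ≤ y i a := by
    intro d
    induction d with
    | zero => exact h.inter
    | succ d ih =>
      intro i a
      exact (h.inter (i + 1 + d) a).trans ((h.le _ _).trans (ih i a))
  refine ⟨fun i j1 j2 hj h1 h2 => ?_, fun i1 i2 j hi h1 h2 h3 h4 => ?_, fun i j hij => if_neg hij,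
    fun i j h1 h2 => ?_⟩
  · rw [← Nat.lt_succ_iff, toFilling_lt_iff h h1 (by omega)]
    exact hj.trans ((toFilling_lt_iff h (by omega) h2 _).1 (Nat.lt_succ_self _))
  · rw [toFilling_lt_iff h h1 h2]
    obtain ⟨d, rfl⟩ := Nat.exists_eq_add_of_lt hi
    have := (toFilling_lt_iff h h3 h4 _).1 (Nat.lt_succ_self _)
    rw [show i1 + d + 1 = i1 + 1 + d by omega] at this ⊢
    exact this.trans_le (hcol d i1 _)
  · rw [toFilling_lt_iff h h1 h2, h.top i k le_rfl]
    exact h2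

theorem toFilling_toChain (hl : Antitone l) (hg : Antitone g) (hlg : l ≤ g)
    (h : IsFilling k l g T) : toFilling l g (toChain l g T) = T := by
  funext i j
  by_cases hij : l i ≤ j ∧ j < g i
  · refine eq_of_forall_gt_iff fun a => ?_
    rw [toFilling_lt_iff (h.toChain hl hg hlg) hij.1 hij.2, h.lt_iff hij.1 hij.2]
  · rw [toFilling, if_neg hij, h.zero i j hij]

theorem toChain_toFilling (h : IsStripChain k l g y) : toChain l g (toFilling l g y) = y := by
  funext i a
  have h1 := h.bot_le i a
  have h2 := h.le_top i a
  have : ({j ∈ Ico (l i) (g i) | toFilling l g y i j < a}) = Ico (l i) (y i a) := by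
    ext j
    rw [mem_filter, mem_Ico, mem_Ico]
    constructor
    · rintro ⟨hj, hja⟩
      exact ⟨hj.1, (toFilling_lt_iff h hj.1 hj.2 a).1 hja⟩
    · rintro ⟨hj, hja⟩
      exact ⟨⟨hj, by omega⟩, (toFilling_lt_iff h hj (by omega) a).2 hja⟩
  rw [toChain, this, Nat.card_Ico]
  omega

end filling

/-! ### Counting letters in skew diagrams. -/

section boxes

variable {k : ℕ}

/-- Extension of a tuple by zero. -/
def extend (v : Fin k → ℕ) (i : ℕ) : ℕ := if h : i < k then v ⟨i, h⟩ else 0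

theorem extend_of_le (v : Fin k → ℕ) {i : ℕ} (h : k ≤ i) : extend v i = 0 :=
  dif_neg (not_lt.2 h)

@[simp] theorem extend_val (v : Fin k → ℕ) (i : Fin k) : extend v i = v i := dif_pos i.2

theorem extend_antitone {v : Fin k → ℕ} (hv : Antitone v) : Antitone (extend v) := by
  intro i j hij
  by_cases hj : j < k
  · rw [extend, extend, dif_pos hj, dif_pos (hij.trans_lt hj)]
    exact hv hij
  · rw [extend_of_le v (not_lt.1 hj)]
    exact Nat.zero_le _

theorem mem_boxes_iff {v : Fin k → ℕ} {c : ℕ × ℕ} : c ∈ boxes v ↔ c.2 < extend v c.1 := by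
  rw [mem_boxes, extend]
  constructor
  · rintro ⟨h, h2⟩
    rwa [dif_pos h]
  · intro h
    split_ifs at h with hk
    · exact ⟨hk, h⟩
    · exact absurd h (Nat.not_lt_zero _)

theorem mem_skewBoxes_iff {g l : Fin k → ℕ} {c : ℕ × ℕ} :
    c ∈ skewBoxes g l ↔ extend l c.1 ≤ c.2 ∧ c.2 < extend g c.1 := by
  rw [skewBoxes, mem_sdiff, mem_boxes_iff, mem_boxes_iff, not_lt, and_comm]

theorem extend_zero : extend (0 : Fin k → ℕ) = 0 := by
  funext i
  rw [extend]
  split_ifs <;> rfl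

theorem boxes_eq_skewBoxes (g : Fin k → ℕ) : boxes g = skewBoxes g 0 := by
  ext c
  rw [mem_skewBoxes_iff, mem_boxes_iff, extend_zero]
  simp

theorem fst_lt_of_mem_skewBoxes {g l : Fin k → ℕ} {c : ℕ × ℕ} (hc : c ∈ skewBoxes g l) :
    c.1 < k := by
  by_contra h
  rw [mem_skewBoxes_iff, extend_of_le g (not_lt.1 h)] at hc
  omega

/-- The number of letters `a` in the first `m` rows. -/
theorem card_filter_skewBoxes {g l : Fin k → ℕ} {T y : ℕ → ℕ → ℕ}
    (hy : IsStripChain k (extend l) (extend g) y)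
    (hT : ∀ i j, extend l i ≤ j → j < extend g i → ∀ a, T i j < a ↔ j < y i a) (m a : ℕ) :
    #{c ∈ skewBoxes g l | c.1 < m ∧ T c.1 c.2 = a} =
      ∑ i ∈ range m, (y i (a + 1) - y i a) := by
  rw [card_eq_sum_card_fiberwise (f := Prod.fst) (t := range m)
    (fun c hc => by simpa using (mem_filter.1 hc).2.1)]
  refine sum_congr rfl fun i hi => ?_
  rw [← Nat.card_Ico, ← card_image_of_injective (Ico (y i a) (y i (a + 1)))
    (Prod.mk_right_injective i)]
  congr 1
  ext ⟨i', j⟩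
  have h1 := hy.bot_le i a
  have h2 := hy.le_top i (a + 1)
  simp only [mem_filter, mem_image, mem_skewBoxes_iff, mem_Ico, Prod.mk.injEq]
  constructor
  · rintro ⟨⟨hb, -, hTa⟩, rfl⟩
    have t1 := hT i' j hb.1 hb.2 a
    have t2 := hT i' j hb.1 hb.2 (a + 1)
    exact ⟨j, by omega, rfl, rfl⟩
  · rintro ⟨j', hj, rfl, rfl⟩
    have t1 := hT i j' (by omega) (by omega) a
    have t2 := hT i j' (by omega) (by omega) (a + 1)
    exact ⟨⟨⟨by omega, by omega⟩, mem_range.1 hi, by omega⟩, rfl⟩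

theorem card_filter_skewBoxes_top {g l : Fin k → ℕ} {T y : ℕ → ℕ → ℕ}
    (hy : IsStripChain k (extend l) (extend g) y)
    (hT : ∀ i j, extend l i ≤ j → j < extend g i → ∀ a, T i j < a ↔ j < y i a) (a : ℕ) :
    #{c ∈ skewBoxes g l | T c.1 c.2 = a} = ∑ i ∈ range k, (y i (a + 1) - y i a) := by
  rw [← card_filter_skewBoxes hy hT]
  congr 1
  refine filter_congr fun c hc => ?_
  have := fst_lt_of_mem_skewBoxes hc
  tauto

end boxes

/-! ### Kostka numbers count patterns. -/

section kostka

variable {k : ℕ}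

theorem isStripChain_zero_iff {g : ℕ → ℕ} {y : ℕ → ℕ → ℕ} :
    IsStripChain k 0 g y ↔ IsGT k g fun j r => y r j :=
  ⟨fun h => ⟨h.bot, fun j hj r => h.top r j hj, fun j r => h.le r j, fun j r => h.inter r j⟩,
    fun h => ⟨h.zero, fun r j hj => h.top j hj r, fun r j => h.le j r, fun r j => h.inter j r⟩⟩

theorem gtWeight_eq_sum {e : ℕ → ℕ} {x : ℕ → ℕ → ℕ} (hx : IsGT k e x) (i : Fin k) :
    gtWeight k x i = ∑ r ∈ range k, (x (i + 1) r - x i r) := by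
  rw [gtWeight, rowSum, rowSum, sum_tsub_distrib _ fun r _ => hx.le i r]

theorem isFilling_of_ssyt {lam : Fin k → ℕ} (hlam : Antitone lam)
    (T : SemistandardYoungTableau (diagram lam hlam)) (hT : ∀ c ∈ boxes lam, T c.1 c.2 < k) :
    IsFilling k 0 (extend lam) T where
  row _ _ _ hj _ h2 := T.row_weak hj (mem_boxes_iff.2 h2)
  col _ _ _ hi _ _ _ h2 := T.col_strict hi (mem_boxes_iff.2 h2)
  zero _ _ h := T.zeros fun hc => h ⟨Nat.zero_le _, mem_boxes_iff.1 hc⟩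
  lt i j _ h := hT (i, j) (mem_boxes_iff.2 h)

/-- The tableau with a given entry function. -/
def ssytOfFilling {lam : Fin k → ℕ} (hlam : Antitone lam) {T : ℕ → ℕ → ℕ}
    (hT : IsFilling k 0 (extend lam) T) : SemistandardYoungTableau (diagram lam hlam) where
  entry := T
  row_weak' hj hc := hT.row _ _ _ hj (Nat.zero_le _) (mem_boxes_iff.1 hc)
  col_strict' hi hc := hT.col _ _ _ hi (Nat.zero_le _)
    ((mem_boxes_iff.1 hc).trans_le (extend_antitone hlam hi.le)) (Nat.zero_le _)
    (mem_boxes_iff.1 hc)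
  zeros' hc := hT.zero _ _ fun h => hc (mem_boxes_iff.2 h.2)

theorem gtWeight_eq_iff {lam mu : Fin k → ℕ} {T y : ℕ → ℕ → ℕ}
    (hy : IsStripChain k 0 (extend lam) y)
    (hT : ∀ i j, 0 ≤ j → j < extend lam i → ∀ a, T i j < a ↔ j < y i a) :
    (gtWeight k (fun j r => y r j) = mu) ↔
      ∀ a : Fin k, #{c ∈ boxes lam | T c.1 c.2 = a} = mu a := by
  rw [funext_iff]
  refine forall_congr' fun a => ?_
  rw [gtWeight_eq_sum (isStripChain_zero_iff.1 hy), boxes_eq_skewBoxes,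
    card_filter_skewBoxes_top (y := y) (by rwa [extend_zero]) (by rwa [extend_zero])]

/-- A straight tableau is a filling above the empty shape, and its chain with indices exchanged is a
pattern. This transfers the Bender–Knuth symmetry to Kostka numbers. -/
theorem kostka_eq_gtCount {lam : Fin k → ℕ} (hlam : Antitone lam) (mu : Fin k → ℕ) :
    kostka lam hlam mu = gtCount k (extend lam) mu := by
  have h0 : Antitone (0 : ℕ → ℕ) := fun _ _ _ => le_rfl
  have hle : (0 : ℕ → ℕ) ≤ extend lam := fun _ => Nat.zero_le _
  have hg := extend_antitone hlam
  rw [kostka, gtCount, ← Nat.card_eq_finsetCard]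
  refine Nat.card_congr
    { toFun := fun T => ⟨fun j r => toChain 0 (extend lam) T.1 r j, ?_⟩
      invFun := fun x => ⟨ssytOfFilling hlam (T := toFilling 0 (extend lam) fun r j => x.1 j r) ?_,
        ?_, ?_⟩
      left_inv := ?_
      right_inv := ?_ }
  · have hf := isFilling_of_ssyt hlam T.1 T.2.1
    have hc := hf.toChain h0 hg hle
    rw [mem_filter, mem_gtSet]
    exact ⟨isStripChain_zero_iff.1 hc,
      (gtWeight_eq_iff hc fun i j h1 h2 a => hf.lt_iff h1 h2 a).2 T.2.2⟩
  · exact (isStripChain_zero_iff.2 (mem_gtSet.1 (mem_filter.1 x.2).1)).toFilling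
  · have hc := isStripChain_zero_iff.2 (mem_gtSet.1 (mem_filter.1 x.2).1)
    intro c hcm
    exact hc.toFilling.lt c.1 c.2 (Nat.zero_le _) (mem_boxes_iff.1 hcm)
  · have hc := isStripChain_zero_iff.2 (mem_gtSet.1 (mem_filter.1 x.2).1)
    exact (gtWeight_eq_iff hc fun i j h1 h2 a => toFilling_lt_iff hc h1 h2 a).1
      (mem_filter.1 x.2).2
  · intro T
    refine Subtype.ext (SemistandardYoungTableau.ext fun i j => ?_)
    exact congrFun (congrFun
      (toFilling_toChain h0 hg hle (isFilling_of_ssyt hlam T.1 T.2.1)) i) j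
  · intro x
    have hc := isStripChain_zero_iff.2 (mem_gtSet.1 (mem_filter.1 x.2).1)
    refine Subtype.ext (funext fun j => funext fun r => ?_)
    exact congrFun (congrFun (toChain_toFilling hc) r) j

theorem kostka_comp {lam : Fin k → ℕ} (hlam : Antitone lam) (mu : Fin k → ℕ)
    (σ : Equiv.Perm (Fin k)) : kostka lam hlam (mu ∘ σ) = kostka lam hlam mu := by
  rw [kostka_eq_gtCount, kostka_eq_gtCount, gtCount_comp]

theorem kostka_sortDown {lam : Fin k → ℕ} (hlam : Antitone lam) (mu : Fin k → ℕ) :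
    kostka lam hlam (sortDown mu) = kostka lam hlam mu :=
  (kostka_comp hlam (sortUp mu) Fin.revPerm).trans (kostka_comp hlam mu _)

end kostka

/-! ### Companion patterns: exchanging rows and letters. -/

section companion

variable {k : ℕ} {l g e : ℕ → ℕ} {x y : ℕ → ℕ → ℕ}

/-- The lattice condition for a chain of horizontal strips: there are at least as many letters `a`
in the first `j` rows as letters `a + 1` in the first `j + 1` rows. -/
def IsLatticeChain (y : ℕ → ℕ → ℕ) : Prop :=
  ∀ j a, ∑ i ∈ range (j + 1), (y i (a + 2) - y i (a + 1)) ≤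
    ∑ i ∈ range j, (y i (a + 1) - y i a)

/-- The companion pattern of a chain: the number of letters `a` in the first `j` rows. -/
def companion (y : ℕ → ℕ → ℕ) (j a : ℕ) : ℕ := ∑ i ∈ range j, (y i (a + 1) - y i a)

/-- The chain with a given companion pattern. -/
def ofCompanion (l : ℕ → ℕ) (x : ℕ → ℕ → ℕ) (i a : ℕ) : ℕ :=
  l i + (headSum x (i + 1) a - headSum x i a)

theorem headSum_companion (hy : IsStripChain k l g y) (j a : ℕ) :
    headSum (companion y) j a = ∑ i ∈ range j, (y i a - l i) := by
  simp only [headSum, companion]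
  rw [sum_comm]
  refine sum_congr rfl fun i _ => ?_
  rw [sum_range_tsub (hy.mono i), hy.bot]

theorem headSum_companion_succ (hy : IsStripChain k l g y) (j a : ℕ) :
    headSum (companion y) (j + 1) a + l j = headSum (companion y) j a + y j a := by
  rw [headSum_companion hy, headSum_companion hy, sum_range_succ]
  have := hy.bot_le j a
  omega

theorem ofCompanion_companion (hy : IsStripChain k l g y) :
    ofCompanion l (companion y) = y := by
  funext i a
  have h1 := headSum_companion_succ hy i a
  have h2 := hy.bot_le i a
  rw [ofCompanion]
  omega

theorem IsGT.headSum_le (hx : IsGT k e x) (j a : ℕ) : headSum x j a ≤ headSum x (j + 1) a :=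
  sum_le_sum fun r _ => hx.le j r

theorem companion_ofCompanion (hx : IsGT k e x) : companion (ofCompanion l x) = x := by
  funext j a
  rw [companion]
  have h : ∀ i ∈ range j, ofCompanion l x i (a + 1) - ofCompanion l x i a =
      x (i + 1) a - x i a := fun i _ => by
    have h1 := hx.headSum_le i a
    have h2 := hx.le i a
    rw [ofCompanion, ofCompanion, headSum_succ, headSum_succ]
    omega
  rw [sum_congr rfl h, sum_range_tsub (f := fun j => x j a) (hx.mono a), hx.zero, Nat.sub_zero]

/-- Interlacing of the companion is literally the lattice condition on the chain, and its top row is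
the weight of the chain. -/
theorem IsStripChain.companion (hy : IsStripChain k l g y) (hg : ∀ i, k ≤ i → g i = 0)
    (he : ∀ a, k ≤ a → e a = 0)
    (hw : ∀ a, a < k → ∑ i ∈ range k, (y i (a + 1) - y i a) = e a) (hL : IsLatticeChain y) :
    IsGT k e (companion y) := by
  refine ⟨fun r => by simp [KostkaLR.companion], fun j hj a => ?_, fun j a => ?_, hL⟩
  · have h : KostkaLR.companion y j a = ∑ i ∈ range k, (y i (a + 1) - y i a) := by
      refine (sum_subset (range_mono hj) fun i _ hi => ?_).symm
      have := hy.le_top i (a + 1)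
      rw [hg i (by simpa using hi)] at this
      omega
    rw [h]
    by_cases ha : a < k
    · exact hw a ha
    · rw [he a (by omega)]
      refine sum_eq_zero fun i _ => ?_
      rw [hy.top i a (by omega), hy.top i (a + 1) (by omega), Nat.sub_self]
  · exact sum_le_sum_of_subset (range_mono (Nat.le_succ j))

/-- Dually, row dominance of the companion is the horizontal-strip inequality `y (i + 1) (a + 1) ≤ y
i a`, rewritten through partial sums. -/
theorem rowDominant_companion (hy : IsStripChain k l g y) : RowDominant k l (companion y) := by
  intro i hi a
  have h1 := headSum_companion_succ hy i a
  have h2 := headSum_companion_succ hy (i + 1) (a + 1)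
  have h3 := hy.inter i a
  have e2 : headSum (companion y) (i + 1 + 1) (a + 1) = headSum (companion y) (i + 2) (a + 1) := rfl
  omega

theorem add_gtWeight_companion (hy : IsStripChain k l g y) (i : Fin k) :
    l i + gtWeight k (companion y) i = g i := by
  have h1 := headSum_companion_succ hy i k
  have h2 := hy.bot_le i k
  rw [hy.top i k le_rfl] at h1 h2
  have h3 : gtWeight k (companion y) i =
    headSum (companion y) (i + 1) k - headSum (companion y) i k := rfl
  omega

theorem IsGT.headSum_of_le (hx : IsGT k e x) (j : ℕ) {a : ℕ} (ha : k ≤ a) :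
    headSum x j a = rowSum k x j := by
  refine (sum_subset (range_mono ha) fun r _ hr => ?_).symm
  exact hx.eq_zero_of_le (by simpa using hr)

theorem isStripChain_ofCompanion (hx : IsGT k e x) (hl : ∀ i, k ≤ i → l i = 0)
    (hg : ∀ i, k ≤ i → g i = 0) (hd : RowDominant k l x)
    (hw : ∀ i : Fin k, l i + gtWeight k x i = g i) : IsStripChain k l g (ofCompanion l x) := by
  have hz : ∀ i a, k ≤ i → ofCompanion l x i a = 0 := fun i a hi => by
    have : headSum x (i + 1) a = headSum x i a := sum_congr rfl fun r _ => by
      rw [hx.top i hi, hx.top (i + 1) (by omega)]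
    rw [ofCompanion, this, hl i hi, Nat.sub_self]
  refine ⟨fun i => by simp [ofCompanion, headSum], fun i a ha => ?_, fun i a => ?_, fun i a => ?_⟩
  · by_cases hi : i < k
    · rw [ofCompanion, hx.headSum_of_le _ ha, hx.headSum_of_le _ ha]
      exact hw ⟨i, hi⟩
    · rw [hz i a (by omega), hg i (by omega)]
  · have h1 := hx.headSum_le i a
    have h2 := hx.le i a
    rw [ofCompanion, ofCompanion, headSum_succ, headSum_succ]
    omega
  · by_cases hi : i + 1 < k
    · have h := hd i hi a
      have h1 := hx.headSum_le i a
      have h2 : headSum x (i + 1) (a + 1) ≤ headSum x (i + 2) (a + 1) := hx.headSum_le (i + 1) _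
      rw [ofCompanion, ofCompanion, show i + 1 + 1 = i + 2 from rfl]
      omega
    · rw [hz _ _ (by omega)]
      exact Nat.zero_le _

theorem isLatticeChain_ofCompanion (hx : IsGT k e x) : IsLatticeChain (ofCompanion l x) := by
  intro j a
  have h1 := hx.inter j a
  rw [← companion_ofCompanion (l := l) hx] at h1
  exact h1

theorem sum_ofCompanion (hx : IsGT k e x) (a : ℕ) :
    ∑ i ∈ range k, (ofCompanion l x i (a + 1) - ofCompanion l x i a) = e a := by
  rw [← hx.top k le_rfl a]
  exact congrFun (congrFun (companion_ofCompanion hx) k) a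

end companion

/-! ### Lattice words and Littlewood–Richardson coefficients. -/

section lattice

variable {k : ℕ} {gam lam mu : Fin k → ℕ}

theorem SkewTableau.ext_entry {T T' : SkewTableau gam lam} (h : T.entry = T'.entry) : T = T' := by
  cases T; cases T'; congr

theorem SkewTableau.isFilling (T : SkewTableau gam lam)
    (hT : ∀ c ∈ skewBoxes gam lam, T.entry c.1 c.2 < k) :
    IsFilling k (extend lam) (extend gam) T.entry where
  row i j1 j2 hj h1 h2 := T.row_weak hj (mem_skewBoxes_iff.2 ⟨h1, by simp only; omega⟩)
    (mem_skewBoxes_iff.2 ⟨by simp only; omega, h2⟩)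
  col _ _ _ hi h1 h2 h3 h4 := T.col_strict hi (mem_skewBoxes_iff.2 ⟨h1, h2⟩)
    (mem_skewBoxes_iff.2 ⟨h3, h4⟩)
  zero _ _ h := T.zeros fun hc => h (mem_skewBoxes_iff.1 hc)
  lt i j h1 h2 := hT (i, j) (mem_skewBoxes_iff.2 ⟨h1, h2⟩)

/-- The skew tableau with a given entry function. -/
def skewOfFilling {T : ℕ → ℕ → ℕ} (hT : IsFilling k (extend lam) (extend gam) T) :
    SkewTableau gam lam where
  entry := T
  row_weak hj h1 h2 := hT.row _ _ _ hj (mem_skewBoxes_iff.1 h1).1 (mem_skewBoxes_iff.1 h2).2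
  col_strict hi h1 h2 := hT.col _ _ _ hi (mem_skewBoxes_iff.1 h1).1 (mem_skewBoxes_iff.1 h1).2
    (mem_skewBoxes_iff.1 h2).1 (mem_skewBoxes_iff.1 h2).2
  zeros hc := hT.zero _ _ fun h => hc (mem_skewBoxes_iff.2 h)

/-- The row-reading word is a lattice word if and only if the chain of shapes satisfies the lattice
condition. -/
theorem SkewTableau.isLattice_iff (T : SkewTableau gam lam) {y : ℕ → ℕ → ℕ}
    (hy : IsStripChain k (extend lam) (extend gam) y)
    (hT : ∀ i j, extend lam i ≤ j → j < extend gam i → ∀ a, T.entry i j < a ↔ j < y i a) :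
    T.IsLattice ↔ IsLatticeChain y := by
  constructor
  · intro h
    have key : ∀ j a, y j (a + 1) < y j (a + 2) →
        ∑ i ∈ range (j + 1), (y i (a + 2) - y i (a + 1)) ≤
          ∑ i ∈ range j, (y i (a + 1) - y i a) := by
      intro j a hlt
      -- The box `(j, y j (a + 1))` holds the leftmost `a + 1` of row `j`: the prefix ending there
      -- contains every `a + 1` of that row but none of its letters `a`.
      have hb := hy.bot_le j (a + 1)
      have ht := hlt.trans_le (hy.le_top j (a + 2))
      have h0 := h (j, y j (a + 1)) (mem_skewBoxes_iff.2 ⟨hb, ht⟩) a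
      rw [← card_filter_skewBoxes hy hT, ← card_filter_skewBoxes hy hT]
      refine (card_le_card ?_).trans (h0.trans (card_le_card ?_))
      · rintro ⟨i', j'⟩ hd
        simp only [readUpTo, filter_filter, mem_filter] at hd ⊢
        refine ⟨hd.1, ?_, hd.2.2⟩
        rcases (Nat.lt_succ_iff.1 hd.2.1).lt_or_eq with hlt | rfl
        · exact Or.inl hlt
        · obtain ⟨hb1, hb2⟩ := mem_skewBoxes_iff.1 hd.1
          have := hT i' j' hb1 hb2 (a + 1)
          exact Or.inr ⟨rfl, by omega⟩
      · rintro ⟨i', j'⟩ hd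
        simp only [readUpTo, filter_filter, mem_filter] at hd ⊢
        refine ⟨hd.1, ?_, hd.2.2⟩
        rcases hd.2.1 with hlt | ⟨rfl, hle⟩
        · exact hlt
        · obtain ⟨hb1, hb2⟩ := mem_skewBoxes_iff.1 hd.1
          have := hT i' j' hb1 hb2 (a + 1)
          omega
    intro j a
    by_cases hlt : y j (a + 1) < y j (a + 2)
    · exact key j a hlt
    -- A row without `a + 1` adds nothing to the left side, so the bound is inherited from the row
    -- above.
    · induction j with
      | zero =>
        rw [sum_range_one, Nat.sub_eq_zero_of_le (not_lt.1 hlt)]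
        exact Nat.zero_le _
      | succ j ih =>
        rw [sum_range_succ, Nat.sub_eq_zero_of_le (not_lt.1 hlt), add_zero]
        refine le_trans ?_ (sum_le_sum_of_subset (range_mono (Nat.le_succ j)))
        by_cases hlt' : y j (a + 1) < y j (a + 2)
        · exact key j a hlt'
        · exact ih hlt'
  · intro h c hc a
    -- A prefix ending in row `c.1` has its letters `a + 1` in the first `c.1 + 1` rows and contains
    -- every `a` of the first `c.1` rows.
    have h1 : ((readUpTo gam lam c).filter fun d => T.entry d.1 d.2 = a + 1) ⊆
        {d ∈ skewBoxes gam lam | d.1 < c.1 + 1 ∧ T.entry d.1 d.2 = a + 1} := fun d hd => by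
      rw [readUpTo, filter_filter, mem_filter] at hd
      rw [mem_filter]
      exact ⟨hd.1, by omega, hd.2.2⟩
    have h2 : ({d ∈ skewBoxes gam lam | d.1 < c.1 ∧ T.entry d.1 d.2 = a}) ⊆
        (readUpTo gam lam c).filter fun d => T.entry d.1 d.2 = a := fun d hd => by
      rw [readUpTo, filter_filter, mem_filter]
      rw [mem_filter] at hd
      exact ⟨hd.1, Or.inl hd.2.1, hd.2.2⟩
    have h1' := card_le_card h1
    have h2' := card_le_card h2
    rw [card_filter_skewBoxes hy hT] at h1' h2'
    exact h1'.trans ((h c.1 a).trans h2')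

theorem SkewTableau.hasWeight_iff {T : ℕ → ℕ → ℕ} {y : ℕ → ℕ → ℕ}
    (hy : IsStripChain k (extend lam) (extend gam) y)
    (hT : ∀ i j, extend lam i ≤ j → j < extend gam i → ∀ a, T i j < a ↔ j < y i a) :
    (∀ a : Fin k, #{c ∈ skewBoxes gam lam | T c.1 c.2 = a} = mu a) ↔
      ∀ a, a < k → ∑ i ∈ range k, (y i (a + 1) - y i a) = extend mu a := by
  constructor
  · intro h a ha
    rw [← card_filter_skewBoxes_top hy hT, h ⟨a, ha⟩, extend, dif_pos ha]
  · intro h a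
    rw [card_filter_skewBoxes_top hy hT, h a a.2, extend_val]

/-- Littlewood–Richardson tableaux correspond to dominant companion patterns. -/
theorem lrCoeff_eq_card (hgam : Antitone gam) (hlam : Antitone lam) (mu : Fin k → ℕ) :
    open Classical in
    lrCoeff gam lam mu = #{x ∈ gtSet k (extend mu) |
      RowDominant k (extend lam) x ∧ (fun i : Fin k => extend lam i) + gtWeight k x = gam} := by
  classical
  rw [lrCoeff]
  split_ifs with hle
  · have hl := extend_antitone hlam
    have hg := extend_antitone hgam
    have hlg : extend lam ≤ extend gam := fun i => by
      by_cases hi : i < k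
      · rw [extend, extend, dif_pos hi, dif_pos hi]
        exact hle _
      · rw [extend_of_le lam (not_lt.1 hi)]
        exact Nat.zero_le _
    have hlk : ∀ i, k ≤ i → extend lam i = 0 := fun _ => extend_of_le lam
    have hgk : ∀ i, k ≤ i → extend gam i = 0 := fun _ => extend_of_le gam
    have hmk : ∀ i, k ≤ i → extend mu i = 0 := fun _ => extend_of_le mu
    have hto : ∀ T : {T : SkewTableau gam lam // T.HasWeight mu ∧ T.IsLattice},
        IsFilling k (extend lam) (extend gam) T.1.entry ∧
        IsStripChain k (extend lam) (extend gam)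
          (toChain (extend lam) (extend gam) T.1.entry) := fun T =>
      ⟨T.1.isFilling T.2.1.1, (T.1.isFilling T.2.1.1).toChain hl hg hlg⟩
    have hof : ∀ x ∈ ({x ∈ gtSet k (extend mu) | RowDominant k (extend lam) x ∧
        (fun i : Fin k => extend lam i) + gtWeight k x = gam}),
        IsGT k (extend mu) x ∧
        IsStripChain k (extend lam) (extend gam) (ofCompanion (extend lam) x) := by
      intro x hx
      rw [mem_filter, mem_gtSet] at hx
      refine ⟨hx.1, isStripChain_ofCompanion hx.1 hlk hgk hx.2.1 fun i => ?_⟩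
      rw [extend_val gam, ← congrFun hx.2.2 i]
      rfl
    rw [← Nat.card_eq_finsetCard]
    refine Nat.card_congr
      { toFun := fun T => ⟨companion (toChain (extend lam) (extend gam) T.1.entry), ?_⟩
        invFun := fun x => ⟨skewOfFilling (hof x.1 x.2).2.toFilling, ⟨?_, ?_⟩, ?_⟩
        left_inv := ?_
        right_inv := ?_ }
    · obtain ⟨hf, hc⟩ := hto T
      rw [mem_filter, mem_gtSet]
      refine ⟨hc.companion hgk hmk ?_ ?_, rowDominant_companion hc, funext fun i => ?_⟩
      · exact (SkewTableau.hasWeight_iff hc fun _ _ h1 h2 a => hf.lt_iff h1 h2 a).1 T.2.1.2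
      · exact (T.1.isLattice_iff hc fun _ _ h1 h2 a => hf.lt_iff h1 h2 a).1 T.2.2
      · rw [← extend_val gam, ← add_gtWeight_companion hc i]
        rfl
    · intro c hc
      rw [mem_skewBoxes_iff] at hc
      exact (hof x.1 x.2).2.toFilling.lt _ _ hc.1 hc.2
    · obtain ⟨hx, hc⟩ := hof x.1 x.2
      exact (SkewTableau.hasWeight_iff hc fun _ _ h1 h2 a => toFilling_lt_iff hc h1 h2 a).2
        fun a _ => sum_ofCompanion hx a
    · obtain ⟨hx, hc⟩ := hof x.1 x.2
      exact (SkewTableau.isLattice_iff _ hc fun _ _ h1 h2 a => toFilling_lt_iff hc h1 h2 a).2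
        (isLatticeChain_ofCompanion hx)
    · intro T
      obtain ⟨hf, hc⟩ := hto T
      refine Subtype.ext (SkewTableau.ext_entry ?_)
      change toFilling _ _ (ofCompanion _ (companion _)) = _
      rw [ofCompanion_companion hc, toFilling_toChain hl hg hlg hf]
    · intro x
      obtain ⟨hx, hc⟩ := hof x.1 x.2
      refine Subtype.ext ?_
      change companion (toChain _ _ (toFilling _ _ _)) = _
      rw [toChain_toFilling hc, companion_ofCompanion hx]
  · symm
    rw [card_eq_zero, filter_eq_empty_iff]
    rintro x - ⟨-, h⟩
    refine hle fun i => ?_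
    rw [← h, Pi.add_apply, extend_val]
    exact Nat.le_add_right _ _

end lattice

/-! ### The two signed sums. -/

section main

variable {k : ℕ}

theorem toPartition_add_staircase {v : Fin k → ℕ} (hv : StrictMono v) (hpos : ∀ i, 1 ≤ v i) :
    toPartition v + staircase k = v ∘ Fin.revPerm := by
  funext i
  have h := cast_toPartition hv hpos i
  have hi := i.2
  simp only [Pi.add_apply, staircase, Function.comp_apply, Fin.revPerm_apply]
  omega

theorem toPartition_antitone {v : Fin k → ℕ} (hv : StrictMono v) (hpos : ∀ i, 1 ≤ v i) :
    Antitone (toPartition v) := by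
  cases k with
  | zero => exact fun i => i.elim0
  | succ n =>
    rw [Fin.antitone_iff_succ_le]
    intro i
    have h1 := cast_toPartition hv hpos i.castSucc
    have h2 := cast_toPartition hv hpos i.succ
    have h3 : v i.succ.rev < v i.castSucc.rev := hv (Fin.rev_lt_rev.2 Fin.castSucc_lt_succ)
    simp only [Fin.val_castSucc, Fin.val_succ] at h1 h2
    push_cast at h1 h2
    omega

theorem pos_of_mem_admissible {n : ℕ} {lam r v : Fin k → ℕ} (hr : r ∈ incTuples n k)
    (hv : v ∈ admissible lam r) (i : Fin k) : 1 ≤ v i := by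
  obtain ⟨mu, -, p, -, rfl, -⟩ := hv
  exact (hr.1 _).1.trans (Nat.le_add_left _ _)

theorem sum_perms_filter {w : Fin k → ℕ} (hw : Function.Injective w) (P : (Fin k → ℕ) → Prop)
    [DecidablePred P] (F : (Fin k → ℕ) → ℤ) :
    ∑ q ∈ perms w with P q, parity w q * F q =
      ∑ σ : Equiv.Perm (Fin k), (Equiv.Perm.sign σ : ℤ) * if P (w ∘ σ) then F (w ∘ σ) else 0 := by
  rw [sum_filter, perms, sum_image]
  · refine sum_congr rfl fun σ _ => ?_
    rw [parity_comp hw]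
    split_ifs
    · rfl
    · rw [mul_zero]
  · intro σ _ τ _ h
    exact Equiv.ext fun i => hw (congrFun h i)

/-- Under `σ ↦ σ⁻¹` the sign is unchanged, and `v ∘ σ⁻¹ - r` is a rearrangement of `v - r ∘ σ`,
which has the same Kostka number. -/
theorem sum_setQ_eq_sum_setP {lam r v : Fin k → ℕ} (hlam : Antitone lam) (hr : StrictMono r)
    (hv : StrictMono v) :
    ∑ q ∈ setQ r v, parity v q * (kostka lam hlam (sortDown (q - r)) : ℤ) =
      ∑ p ∈ setP r v, parity r p * (kostka lam hlam (sortDown (v - p)) : ℤ) := by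
  rw [setQ, setP, sum_perms_filter hv.injective _ fun q => (kostka lam hlam (sortDown (q - r)) : ℤ),
    sum_perms_filter hr.injective _ fun p => (kostka lam hlam (sortDown (v - p)) : ℤ),
    ← Equiv.sum_comp (Equiv.inv (Equiv.Perm (Fin k)))]
  refine sum_congr rfl fun σ _ => ?_
  have h1 : (∀ i, r i ≤ (v ∘ (σ⁻¹ : Equiv.Perm (Fin k))) i) ↔ ∀ i, (r ∘ σ) i ≤ v i := by
    rw [← σ.forall_congr_right]
    simp
  have h2 : v ∘ (σ⁻¹ : Equiv.Perm (Fin k)) - r =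
      (v - r ∘ σ) ∘ (σ⁻¹ : Equiv.Perm (Fin k)) := by
    funext i
    simp
  simp only [Equiv.inv_apply, Equiv.Perm.sign_inv, h1, h2, kostka_sortDown, kostka_comp]

/-- Adding the staircase to `toPartition r` and `toPartition v` gives `r` and `v` reversed.
Conjugating `σ` by the reversal preserves its sign and matches the terms with those of
`sum_sign_gtCount`. -/
theorem sum_setP_eq_lrCoeff {lam r v : Fin k → ℕ} (hlam : Antitone lam) (hr : StrictMono r)
    (hr0 : ∀ i, 1 ≤ r i) (hv : StrictMono v) (hv0 : ∀ i, 1 ≤ v i) :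
    ∑ p ∈ setP r v, parity r p * (kostka lam hlam (sortDown (v - p)) : ℤ) =
      (lrCoeff (toPartition v) lam (toPartition r) : ℤ) := by
  classical
  rw [lrCoeff_eq_card (toPartition_antitone hv hv0) hlam, ← sum_sign_gtCount
    (extend_antitone hlam) (fun _ => extend_of_le lam)
    (extend_antitone (toPartition_antitone hr hr0)) (fun _ => extend_of_le _)
    (toPartition_antitone hv hv0), setP,
    sum_perms_filter hr.injective _ fun p => (kostka lam hlam (sortDown (v - p)) : ℤ),
    ← Equiv.sum_comp (MulAut.conj (Fin.revPerm (n := k))).toEquiv]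
  have he : (fun i : Fin k => extend (toPartition r) i) = toPartition r :=
    funext fun i => extend_val _ i
  rw [he, toPartition_add_staircase hr hr0, toPartition_add_staircase hv hv0]
  refine sum_congr rfl fun σ _ => ?_
  have h1 : (∀ i, (r ∘ ((MulAut.conj (Fin.revPerm (n := k))).toEquiv σ)) i ≤ v i) ↔
      (r ∘ Fin.revPerm) ∘ σ ≤ v ∘ Fin.revPerm := by
    rw [← (Fin.revPerm (n := k)).forall_congr_right]
    simp [Pi.le_def]
  have h2 : v ∘ Fin.revPerm - (r ∘ Fin.revPerm) ∘ σ =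
      (v - r ∘ ((MulAut.conj (Fin.revPerm (n := k))).toEquiv σ)) ∘ Fin.revPerm := by
    funext i
    simp
  have h3 : Equiv.Perm.sign ((MulAut.conj (Fin.revPerm (n := k))).toEquiv σ) =
      Equiv.Perm.sign σ := by
    change Equiv.Perm.sign (Fin.revPerm * σ * Fin.revPerm⁻¹) = _
    rw [Equiv.Perm.sign_mul, Equiv.Perm.sign_mul, Equiv.Perm.sign_inv, mul_right_comm,
      Int.units_mul_self, one_mul]
  simp only [h1, h2, h3, kostka_sortDown]
  simp only [kostka_eq_gtCount, gtCount_comp]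

end main

end KostkaLR

theorem mainTheorem4 (M N k : ℕ) (lam r v : Fin k → ℕ)
    (hlam : lam ∈ KostkaLR.decTuples M k) (hr : r ∈ KostkaLR.incTuples N k)
    (hv : v ∈ KostkaLR.admissible lam r) :
    (∑ q ∈ KostkaLR.setQ r v,
        KostkaLR.parity v q * (KostkaLR.kostka lam hlam.2 (KostkaLR.sortDown (q - r)) : ℤ) =
      ∑ p ∈ KostkaLR.setP r v,
        KostkaLR.parity r p * (KostkaLR.kostka lam hlam.2 (KostkaLR.sortDown (v - p)) : ℤ)) ∧
    (∑ p ∈ KostkaLR.setP r v,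
        KostkaLR.parity r p * (KostkaLR.kostka lam hlam.2 (KostkaLR.sortDown (v - p)) : ℤ) =
      (KostkaLR.lrCoeff (KostkaLR.toPartition v) lam (KostkaLR.toPartition r) : ℤ)) ∧
    0 ≤ ∑ q ∈ KostkaLR.setQ r v,
        KostkaLR.parity v q * (KostkaLR.kostka lam hlam.2 (KostkaLR.sortDown (q - r)) : ℤ) := by
  have hv' : StrictMono v := by
    obtain ⟨-, -, -, -, -, h⟩ := hv
    exact h
  have h1 := KostkaLR.sum_setQ_eq_sum_setP hlam.2 hr.2 hv'
  have h2 := KostkaLR.sum_setP_eq_lrCoeff hlam.2 hr.2 (fun i => (hr.1 i).1) hv'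
    (KostkaLR.pos_of_mem_admissible hr hv)
  refine ⟨h1, h2, ?_⟩
  rw [h1, h2]
  exact Int.natCast_nonneg _
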